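/- **Setting.** Let $b\in\mathbb R$ and let $\mu$ be a Borel measure on $(0,\infty)$ with $\bar\mu(x):=\mu([x,\infty))<\infty$ for all $x>0$; write $\bar\mu_+(x):=\mu((x,\infty))$ for the strict tail. Let $\mathcal N=\sum_{s\ge 0}\delta_{(s,\xi_s)}$ be a Poisson point process on $[0,\infty)\times(0,\infty)$ with intensity (Lebesgue measure)$\,\times\mu$. For $x\ge 0$ put $\mathcal N^x=\delta_{(0,x)}+\mathcal N$ and $$M^x(t)=\sup\{(\xi-b(t-s))_+ : (s,\xi)\text{ an atom of }\mathcal N^x,\ 0\le s\le t\},\qquad t\ge 0 .$$ Let $\mathbb P_x$ be the law of $M^x$; under $\mathbb P_x$ write $M$ for the process, called the $\mathrm{ESN}(b,\mu)$ process started from $x$. Let $P_tf(x)=\mathbb E_x[f(M(t))]$, and let $C_0([0,\infty))$ be the space of continuous functions on $[0,\infty)$ vanishing at $\infty$. The convention $e^{-\infty}=0$ is used. **Theorem.** 1. Let $n\ge1$, $0=s_0<s_1<\dots<s_n$ and $u_1,\dots,u_n\in[0,\infty)$. Then $$\mathbb P_0(M(s_1)\le u_1,\dots,M(s_n)\le u_n)=\exp\Big(-\sum_{i=1}^n\int_{s_{i-1}}^{s_i}\bar\mu_+\Big(\min_{i\le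 j\le n}(u_j+b(s_j-t))\Big)dt\Big)\prod_{i=1}^n\mathbf 1_{\{u_i\ge(-bs_i)_+\}}.$$ In particular, for $s\ge0$ and $u\in\mathbb R$, $$F^0_s(u):=\mathbb P_0(M(s)\le u)=\exp\Big(-\int_0^s\bar\mu_+(u+b(s-t))\,dt\Big)\mathbf 1_{\{u\ge(-bs)_+\}}.$$ If $b\neq0$, or if $\mu$ has no atoms, both formulas also hold with $\bar\mu$ in place of $\bar\mu_+$. If $b\ne0$, then moreover $$F^0_s(u)=\exp\Big(-\frac1b\int_u^{u+bs}\bar\mu(y)\,dy\Big)\mathbf 1_{\{u\ge(-bs)_+\}}.$$ 2. For all $x,t\ge0$ and $u\in\mathbb R$, $\ \mathbb P_x(M(t)\le u)=F^0_t(u)\,\mathbf 1_{\{u\ge(x-bt)_+\}}$. 3. $M$ is a time-homogeneous Markov process on $[0,\infty)$ with semigroup $(P_t)_{t\ge0}$, and this semigroup is Feller: $P_tC_0([0,\infty))\subset C_0([0,\infty))$ for all $t\ge0$, and $P_tf\to f$ uniformly as $t\to0$ for all $f\in C_0([0,\infty))$. 4. If $b>0$, then for every $s>0$: $\mathbb P_0(M(s)=0)>0$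 if and only if $\int_0^1\bar\mu(v)\,dv<\infty$. If $b=0$, then for every $s>0$: $\mathbb P_0(M(s)=0)>0$ if and only if $\mu((0,\infty))<\infty$. If $b\ge0$ and $\mathbb P_0(M(s)=0)>0$ for all $s>0$, then $\mathbb P_0$-almost surely the zero set $\{t>0:M(t)=0\}$ has strictly positive Lebesgue measure. 5. Let $b>0$. If $\int_1^\infty\bar\mu(u)\,du=\infty$, then for every $x\ge0$, $M(s)\to\infty$ in $\mathbb P_x$-probability as $s\to\infty$. If $\int_1^\infty\bar\mu(u)\,du<\infty$, then $M$ has a stationary probability distribution $\pi$ on $[0,\infty)$ with $$\pi([0,u])=\exp\Big(-\frac1b\int_u^\infty\bar\mu(v)\,dv\Big),\qquad u\ge0,$$ which is not a point mass if $\mu\neq0$. In this case, for every $x\ge0$, $\mathbb P_x(M(t)\in\cdot)$ converges to $\pi$ in total variation as $t\to\infty$, and for every $t>x/b$, $$d_{\mathrm{TV}}\big(\mathbb P_x(M(t)\in\cdot),\pi\big)\le\frac1b\int_{bt}^\infty\bar\mu(u)\,du,\qquad d_{\mathrm{TV}}(p,q)=\sup_A|p(A)-q(A)|,$$ the supremum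 being over Borel sets $A\subset[0,\infty)$. -/

import Mathlib

open MeasureTheory ProbabilityTheory Filter Topology
open scoped NNReal ENNReal

noncomputable section

namespace ESN

/-- The Poisson law on `[0, ∞]` with parameter `a`, where the law with parameter `∞` is the point
mass at `∞`. -/
def poissonLaw (a : ℝ≥0∞) : Measure ℝ≥0∞ :=
  if a = ∞ then Measure.dirac ∞
  else (poissonMeasure a.toNNReal).map (fun k : ℕ => (k : ℝ≥0∞))

/-- `N` is, under `P`, a Poisson point process on `E` with intensity measure `ν`: a random countable
sum of point masses, whose count of a measurable set `B` is Poisson with parameter `ν B`, and whose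
counts of finitely many pairwise disjoint measurable sets are independent. -/
structure IsPoissonPointProcess {Ω E : Type*} [MeasurableSpace Ω] [MeasurableSpace E]
    (P : Measure Ω) (N : Ω → Measure E) (ν : Measure E) : Prop where
  point_measure : ∀ ω, ∃ (I : Set ℕ) (p : ℕ → E),
    N ω = Measure.sum (fun i : I => Measure.dirac (p i))
  measurable_count : ∀ B : Set E, MeasurableSet B → Measurable (fun ω => N ω B)
  law_count : ∀ B : Set E, MeasurableSet B → P.map (fun ω => N ω B) = poissonLaw (ν B)
  indep_count : ∀ (n : ℕ) (B : Fin n → Set E), (∀ i, MeasurableSet (B i)) →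
    Pairwise (fun i j => Disjoint (B i) (B j)) → iIndepFun (fun i ω => N ω (B i)) P

/-- The intensity `λ × μ`, with `λ` the Lebesgue measure on `[0, ∞)`. A measure `μ` on `(0, ∞)` is
represented by a measure on `ℝ` which does not charge `(-∞, 0]`. -/
def intensity (μ : Measure ℝ) : Measure (ℝ × ℝ) := (volume.restrict (Set.Ici 0)).prod μ

/-- The tail `x ↦ μ([x, ∞))`. -/
def tail (μ : Measure ℝ) (x : ℝ) : ℝ≥0∞ := μ (Set.Ici x)

/-- The strict tail `x ↦ μ((x, ∞))`. -/
def strictTail (μ : Measure ℝ) (x : ℝ) : ℝ≥0∞ := μ (Set.Ioi x)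

/-- `exp (-a)` for `a ∈ [0, ∞]`, with `exp (-∞) = 0`. -/
def expNeg (a : ℝ≥0∞) : ℝ := if a = ∞ then 0 else Real.exp (-a.toReal)

/-- The atoms of a measure. -/
def atoms (m : Measure (ℝ × ℝ)) : Set (ℝ × ℝ) := {p | m {p} ≠ 0}

/-- The extremal shot noise process started from `x`: with `N^x = δ_(0,x) + N`,
`M^x(t) = sup {(ξ - b (t - s))₊ : (s, ξ) an atom of N^x, 0 ≤ s ≤ t}`.
For `x = 0` this is the standard process. (Adjoining the atom `(0, 0)` amounts to the convention
that `ξ_s = 0` when there is no atom at time `s`, so that `M^0(t) ≥ (-b t)₊`.)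
For a Poisson point process with intensity `λ × μ`, `μ` having finite tails, the supremum is almost
surely finite. -/
def esn {Ω : Type*} (b : ℝ) (N : Ω → Measure (ℝ × ℝ)) (x t : ℝ≥0) (ω : Ω) : ℝ≥0 :=
  sSup {z : ℝ≥0 | ∃ p ∈ atoms (Measure.dirac ((0 : ℝ), (x : ℝ)) + N ω),
    0 ≤ p.1 ∧ p.1 ≤ t ∧ z = Real.toNNReal (p.2 - b * (t - p.1))}

/-- The one-dimensional law `ℙ_x(M(t) ∈ ·)` on `[0, ∞)`. -/
def esnLaw {Ω : Type*} [MeasurableSpace Ω] (P : Measure Ω) (b : ℝ) (N : Ω → Measure (ℝ × ℝ))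
    (t x : ℝ≥0) : Measure ℝ≥0 :=
  P.map (esn b N x t)

/-- The semigroup `P_t f (x) = 𝔼_x[f(M(t))]`. -/
def esnSemigroup {Ω : Type*} [MeasurableSpace Ω] (P : Measure Ω) (b : ℝ)
    (N : Ω → Measure (ℝ × ℝ)) (t : ℝ≥0) (f : ℝ≥0 → ℝ) (x : ℝ≥0) : ℝ :=
  ∫ y, f y ∂(esnLaw P b N t x)

/-- The σ-algebra generated by the process `X` up to time `t`. -/
abbrev past {Ω : Type*} (X : ℝ≥0 → Ω → ℝ≥0) (t : ℝ≥0) : MeasurableSpace Ω :=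
  ⨆ r : Set.Iic t, MeasurableSpace.comap (X r) inferInstance

/-- The total variation distance `sup_A |p(A) - q(A)|` between probability measures. -/
def tvDist {E : Type*} [MeasurableSpace E] (p q : Measure E) : ℝ :=
  ⨆ A : {A : Set E // MeasurableSet A}, |p.real A.1 - q.real A.1|

/-- The exponent `∑ᵢ ∫_{s_{i-1}}^{s_i} g(min_{j ≥ i} (u_j + b (s_j - t))) dt` of the
finite-dimensional laws, where `s 0 < s 1 < … < s n` and where `u j` is the level at time
`s (j + 1)` for `0 ≤ j < n`. -/
def fddExponent (g : ℝ → ℝ≥0∞) (b : ℝ) {n : ℕ} (s : Fin (n + 1) → ℝ≥0) (u : Fin n → ℝ≥0) :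
    ℝ≥0∞ :=
  ∑ i : Fin n, ∫⁻ t in Set.Ioc (s i.castSucc : ℝ) (s i.succ : ℝ),
    g ((Finset.Ici i).inf' ⟨i, Finset.mem_Ici.2 le_rfl⟩
      (fun j => (u j : ℝ) + b * ((s j.succ : ℝ) - t)))

end ESN

end

noncomputable section

namespace ESN

/-! Everything reduces to void probabilities. Almost surely, `M^x(t) ≤ u` holds exactly when `(x -
bt)₊ ≤ u` and `N` has no atom strictly above the line `s ↦ u + b(t - s)` over `[0, t]`. A region `B`
is void with probability `exp(-ν B)`, and Fubini computes `ν B` as the time integral of a strict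
tail. For several times the forbidden region is a union of such sets; over each time slice it is the
region above a minimum of lines, whence the finite-dimensional laws (`fdd_esn`). A line of nonzero
slope meets the countably many atoms of `μ` on a null set of times only, so strict and closed tails
then agree.

The Markov property comes from the recursion `M(t + s) = max((M(t) - bs)₊, Z)` (`ae_esn_add`), where
`Z` depends only on the atoms in `(t, t + s]`, is independent of the past, and has a law depending
only on `s`. Hence `P_s f(x) = E f(max((x - bs)₊, Z))`, from which the semigroup and Feller
properties follow.

For the zero set, the probability that a given time in `(0, ε]` is covered by an earlier atom tends
to 0 with `ε`; Fubini and Markov's inequality then rule out that the zeros are null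
(`ae_volume_zeros_pos`).

For the long run, reversing time turns `M(t)` into the supremum of `(ξ - br)₊` over atoms with `r ≤
t`, once `x ≤ bt`. The stationary law is that of the supremum over all `r > 0`. The two suprema,
taken on the same process, differ only if some atom with `r > t` lies above `br`, and the intensity
of that region is the total variation bound. -/

/-! ### The function `exp(-a)` on `[0, ∞]`. -/

lemma expNeg_top : expNeg ∞ = 0 := by simp [expNeg]

lemma expNeg_of_ne_top {a : ℝ≥0∞} (h : a ≠ ∞) : expNeg a = Real.exp (-a.toReal) := by
  simp [expNeg, h]

lemma expNeg_zero : expNeg 0 = 1 := by simp [expNeg]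

lemma expNeg_nonneg (a : ℝ≥0∞) : 0 ≤ expNeg a := by
  unfold expNeg; split_ifs <;> positivity

lemma expNeg_pos_iff {a : ℝ≥0∞} : 0 < expNeg a ↔ a < ∞ := by
  by_cases h : a = ∞
  · simp [h, expNeg_top]
  · simp [expNeg_of_ne_top h, Real.exp_pos, lt_top_iff_ne_top, h]

lemma expNeg_add (a c : ℝ≥0∞) : expNeg (a + c) = expNeg a * expNeg c := by
  by_cases ha : a = ∞
  · simp [ha, expNeg_top]
  by_cases hc : c = ∞
  · simp [hc, expNeg_top]
  rw [expNeg_of_ne_top ha, expNeg_of_ne_top hc, expNeg_of_ne_top (by simp [ha, hc]),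
    ENNReal.toReal_add ha hc, ← Real.exp_add]
  ring_nf

lemma expNeg_le_one (a : ℝ≥0∞) : expNeg a ≤ 1 := by
  unfold expNeg
  split_ifs
  · exact zero_le_one
  · exact Real.exp_le_one_iff.2 (by simp)

lemma expNeg_antitone : Antitone expNeg := by
  intro a c h
  obtain ⟨d, rfl⟩ := exists_add_of_le h
  rw [expNeg_add]
  exact mul_le_of_le_one_right (expNeg_nonneg _) (expNeg_le_one _)

lemma expNeg_eq_one_iff {a : ℝ≥0∞} : expNeg a = 1 ↔ a = 0 := by
  by_cases h : a = ∞
  · simp [h, expNeg_top]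
  · simp [expNeg_of_ne_top h, ENNReal.toReal_eq_zero_iff, h]

/-- Bounds the probability of hitting a region by its intensity, through `prob_ne_zero_le`. -/
lemma ofReal_one_sub_expNeg_le (a : ℝ≥0∞) : ENNReal.ofReal (1 - expNeg a) ≤ a := by
  by_cases h : a = ∞
  · simp [h]
  · rw [expNeg_of_ne_top h]
    refine ENNReal.ofReal_le_of_le_toReal ?_
    linarith [Real.add_one_le_exp (-a.toReal)]

lemma tendsto_expNeg_top : Tendsto expNeg (𝓝 ∞) (𝓝 0) := by
  rw [tendsto_order]
  refine ⟨fun a ha => Eventually.of_forall fun x => ha.trans_le (expNeg_nonneg x),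
    fun ε hε => ?_⟩
  obtain ⟨r, hr⟩ := (Real.tendsto_exp_neg_atTop_nhds_zero.eventually (gt_mem_nhds hε)).exists
  filter_upwards [lt_mem_nhds (ENNReal.ofReal_lt_top (r := max r 0))] with x hx
  refine (expNeg_antitone hx.le).trans_lt (lt_of_le_of_lt ?_ hr)
  rw [expNeg_of_ne_top ENNReal.ofReal_ne_top, ENNReal.toReal_ofReal (le_max_right _ _)]
  exact Real.exp_le_exp.2 (neg_le_neg (le_max_left _ _))

lemma poissonLaw_zero (a : ℝ≥0∞) : poissonLaw a {0} = ENNReal.ofReal (expNeg a) := by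
  by_cases h : a = ∞
  · simp [poissonLaw, h, expNeg_top]
  · rw [poissonLaw, if_neg h, Measure.map_apply (by fun_prop) (measurableSet_singleton _),
      expNeg_of_ne_top h]
    have : (fun k : ℕ => (k : ℝ≥0∞)) ⁻¹' {0} = {0} := by ext; simp
    rw [this, poissonMeasure_singleton]
    simp [ENNReal.coe_toNNReal_eq_toReal]

/-! ### Void events of a Poisson process and their independence. -/

section Void

variable {Ω E : Type*} [MeasurableSpace E] {N : Ω → Measure E} {ν : Measure E}

/-- The σ-algebra generated by the void events of the measurable subsets of `D`. -/
abbrev voidSigma (N : Ω → Measure E) (D : Set E) : MeasurableSpace Ω :=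
  MeasurableSpace.generateFrom {s | ∃ A ⊆ D, MeasurableSet A ∧ s = {ω | N ω A = 0}}

lemma measurableSet_voidSigma {D A : Set E} (hA : MeasurableSet A) (h : A ⊆ D) :
    MeasurableSet[voidSigma N D] {ω | N ω A = 0} :=
  MeasurableSpace.measurableSet_generateFrom ⟨A, h, hA, rfl⟩

/-- Voidness of `A` and of `B` together is voidness of `A ∪ B`. -/
lemma isPiSystem_void (N : Ω → Measure E) (D : Set E) :
    IsPiSystem {s | ∃ A ⊆ D, MeasurableSet A ∧ s = {ω | N ω A = 0}} := by
  rintro _ ⟨A, hAD, hA, rfl⟩ _ ⟨B, hBD, hB, rfl⟩ -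
  refine ⟨A ∪ B, Set.union_subset hAD hBD, hA.union hB, ?_⟩
  ext ω
  simp

variable [MeasurableSpace Ω] {P : Measure Ω}

/-- A countable sum of point masses has no diffuse part. This translates statements about `atoms`
into statements about counts. -/
lemma IsPoissonPointProcess.eq_zero_iff [MeasurableSingletonClass E]
    (hN : IsPoissonPointProcess P N ν) (ω : Ω) {B : Set E} (hB : MeasurableSet B) :
    N ω B = 0 ↔ ∀ p ∈ B, N ω {p} = 0 := by
  refine ⟨fun h p hp => measure_mono_null (Set.singleton_subset_iff.2 hp) h, fun h => ?_⟩
  obtain ⟨I, p, hp⟩ := hN.point_measure ω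
  rw [hp] at h ⊢
  rw [Measure.sum_apply _ hB, ENNReal.tsum_eq_zero]
  intro i
  rw [Measure.dirac_apply' _ hB, Set.indicator_apply_eq_zero]
  intro hi
  have h' := h _ hi
  rw [Measure.sum_apply _ (measurableSet_singleton _), ENNReal.tsum_eq_zero] at h'
  simpa using h' i

lemma IsPoissonPointProcess.measurableSet_void (hN : IsPoissonPointProcess P N ν) {B : Set E}
    (hB : MeasurableSet B) : MeasurableSet {ω | N ω B = 0} :=
  hN.measurable_count B hB (measurableSet_singleton 0)

lemma IsPoissonPointProcess.void_probability (hN : IsPoissonPointProcess P N ν) {B : Set E}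
    (hB : MeasurableSet B) : P {ω | N ω B = 0} = ENNReal.ofReal (expNeg (ν B)) := by
  rw [← poissonLaw_zero, ← hN.law_count B hB,
    Measure.map_apply (hN.measurable_count B hB) (measurableSet_singleton 0)]
  rfl

lemma IsPoissonPointProcess.void_probability_real (hN : IsPoissonPointProcess P N ν) {B : Set E}
    (hB : MeasurableSet B) : P.real {ω | N ω B = 0} = expNeg (ν B) := by
  rw [Measure.real, hN.void_probability hB, ENNReal.toReal_ofReal (expNeg_nonneg _)]

lemma IsPoissonPointProcess.prob_ne_zero_le [IsProbabilityMeasure P]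
    (hN : IsPoissonPointProcess P N ν) {B : Set E} (hB : MeasurableSet B) :
    P {ω | N ω B ≠ 0} ≤ ν B := by
  have h : {ω | N ω B ≠ 0} = {ω | N ω B = 0}ᶜ := rfl
  rw [h, prob_compl_eq_one_sub (hN.measurableSet_void hB), hN.void_probability hB,
    ← ENNReal.ofReal_one, ← ENNReal.ofReal_sub _ (expNeg_nonneg _)]
  exact ofReal_one_sub_expNeg_le _

lemma IsPoissonPointProcess.voidSigma_le (hN : IsPoissonPointProcess P N ν) (D : Set E) :
    voidSigma N D ≤ (inferInstance : MeasurableSpace Ω) := by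
  refine MeasurableSpace.generateFrom_le ?_
  rintro _ ⟨A, -, hA, rfl⟩
  exact hN.measurableSet_void hA

/-- On the generating π-systems, additivity of `ν` on disjoint sets makes `exp(-ν)` multiplicative.
-/
lemma IsPoissonPointProcess.indep_voidSigma [IsProbabilityMeasure P]
    (hN : IsPoissonPointProcess P N ν) {D D' : Set E} (h : Disjoint D D') :
    Indep (voidSigma N D) (voidSigma N D') P := by
  refine IndepSets.indep (hN.voidSigma_le D) (hN.voidSigma_le D') (isPiSystem_void N D)
    (isPiSystem_void N D') rfl rfl ?_
  rw [IndepSets_iff]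
  rintro _ _ ⟨A, hAD, hA, rfl⟩ ⟨B, hBD, hB, rfl⟩
  have : {ω | N ω A = 0} ∩ {ω | N ω B = 0} = {ω | N ω (A ∪ B) = 0} := by ext; simp
  rw [this, hN.void_probability (hA.union hB), hN.void_probability hA, hN.void_probability hB,
    measure_union (h.mono hAD hBD) hB, expNeg_add, ENNReal.ofReal_mul (expNeg_nonneg _)]

end Void

/-! ### Suprema over atoms and the regions above a curve. -/

/-- The points `(s, ξ)` with `s ∈ I` and `ξ > u + g s`. -/
def above (g : ℝ → ℝ) (I : Set ℝ) (u : ℝ) : Set (ℝ × ℝ) := {p | p.1 ∈ I ∧ u + g p.1 < p.2}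

lemma measurableSet_above {g : ℝ → ℝ} (hg : Measurable g) {I : Set ℝ} (hI : MeasurableSet I)
    (u : ℝ) : MeasurableSet (above g I u) := by
  have h1 : MeasurableSet {p : ℝ × ℝ | u + g p.1 < p.2} :=
    measurableSet_lt (by fun_prop) (by fun_prop)
  exact (measurable_fst hI).inter h1

lemma above_anti (g : ℝ → ℝ) (I : Set ℝ) : Antitone (above g I) := by
  rintro u v h p ⟨h1, h2⟩
  exact ⟨h1, by linarith⟩

lemma above_mono (g : ℝ → ℝ) {I J : Set ℝ} (h : I ⊆ J) (u : ℝ) : above g I u ⊆ above g J u :=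
  fun _ hp => ⟨h hp.1, hp.2⟩

/-- The supremum of `a` and of the values `(ξ - g s)₊` over the atoms `(s, ξ)` of `m` with
`s ∈ I`. -/
def peak (a : ℝ≥0) (g : ℝ → ℝ) (I : Set ℝ) (m : Measure (ℝ × ℝ)) : ℝ≥0 :=
  sSup (insert a {z | ∃ p ∈ atoms m, p.1 ∈ I ∧ z = Real.toNNReal (p.2 - g p.1)})

section Peak

variable {Ω : Type*} [MeasurableSpace Ω] {P : Measure Ω}
  {N : Ω → Measure (ℝ × ℝ)} {ν : Measure (ℝ × ℝ)} {g : ℝ → ℝ} {I : Set ℝ}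

lemma IsPoissonPointProcess.above_eq_zero_iff (hN : IsPoissonPointProcess P N ν)
    (hg : Measurable g) (hI : MeasurableSet I) (ω : Ω) (u : ℝ) :
    N ω (above g I u) = 0 ↔ ∀ p ∈ atoms (N ω), p.1 ∈ I → p.2 - g p.1 ≤ u := by
  rw [hN.eq_zero_iff ω (measurableSet_above hg hI u)]
  refine forall_congr' fun p => ?_
  simp only [above, atoms, Set.mem_ofPred_eq]
  constructor
  · intro h h1 h2
    by_contra h3
    exact h1 (h ⟨h2, by linarith⟩)
  · rintro h ⟨h2, h3⟩
    by_contra h1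
    linarith [h h1 h2]

/-- Boundedness is essential: in `ℝ≥0` an unbounded set has `sSup` equal to 0, which would make the
left side true for every `u`. -/
lemma IsPoissonPointProcess.peak_le_iff_of_bdd (hN : IsPoissonPointProcess P N ν)
    (hg : Measurable g) (hI : MeasurableSet I) (a : ℝ≥0) (ω : Ω) (u : ℝ≥0)
    (h : ∃ k : ℕ, N ω (above g I k) = 0) :
    peak a g I (N ω) ≤ u ↔ a ≤ u ∧ N ω (above g I u) = 0 := by
  obtain ⟨k, hk⟩ := h
  rw [hN.above_eq_zero_iff hg hI] at hk ⊢
  have hb : BddAbove (insert a {z | ∃ p ∈ atoms (N ω), p.1 ∈ I ∧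
      z = Real.toNNReal (p.2 - g p.1)}) := by
    refine BddAbove.insert _ ⟨k, ?_⟩
    rintro _ ⟨p, hp, hpI, rfl⟩
    exact Real.toNNReal_le_iff_le_coe.2 (by simpa using hk p hp hpI)
  rw [peak, csSup_le_iff hb (Set.insert_nonempty _ _)]
  simp only [Set.mem_insert_iff, forall_eq_or_imp, Set.mem_ofPred_eq]
  refine and_congr_right fun _ => ⟨fun h p hp hpI => ?_, ?_⟩
  · exact Real.toNNReal_le_iff_le_coe.1 (h _ ⟨p, hp, hpI, rfl⟩)
  · rintro h _ ⟨p, hp, hpI, rfl⟩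
    exact Real.toNNReal_le_iff_le_coe.2 (h p hp hpI)

lemma IsPoissonPointProcess.peak_of_not_bdd (hN : IsPoissonPointProcess P N ν)
    (hg : Measurable g) (hI : MeasurableSet I) (a : ℝ≥0) (ω : Ω)
    (h : ¬ ∃ k : ℕ, N ω (above g I k) = 0) : peak a g I (N ω) = 0 := by
  rw [peak, csSup_of_not_bddAbove, csSup_empty]
  · rfl
  rintro ⟨c, hc⟩
  obtain ⟨k, hk⟩ := exists_nat_ge c
  refine h ⟨k, (hN.above_eq_zero_iff hg hI _ _).2 fun p hp hpI => ?_⟩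
  have := hc (Set.mem_insert_of_mem _ ⟨p, hp, hpI, rfl⟩)
  exact Real.toNNReal_le_iff_le_coe.1 (this.trans hk)

/-- The σ-algebra is not completed, so the preimage must be identified for every `ω`, including
those where the supremum is infinite and `peak` takes the default value 0. -/
lemma IsPoissonPointProcess.measurable_peak_voidSigma (hN : IsPoissonPointProcess P N ν)
    (hg : Measurable g) (hI : MeasurableSet I) (a : ℝ≥0) {D : Set (ℝ × ℝ)}
    (hD : I ×ˢ Set.univ ⊆ D) :
    Measurable[voidSigma N D] (fun ω => peak a g I (N ω)) := by
  have hsub : ∀ u, above g I u ⊆ D := fun u p hp => hD ⟨hp.1, trivial⟩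
  have hm : ∀ u, MeasurableSet[voidSigma N D] {ω | N ω (above g I u) = 0} := fun u =>
    measurableSet_voidSigma (measurableSet_above hg hI u) (hsub u)
  refine @measurable_of_Iic _ _ _ _ _ (voidSigma N D) _ _ _ _ fun u => ?_
  have hb : MeasurableSet[voidSigma N D] (⋃ k : ℕ, {ω | N ω (above g I k) = 0}) :=
    MeasurableSet.iUnion fun k => hm k
  have : (fun ω => peak a g I (N ω)) ⁻¹' Set.Iic u =
      ((⋃ k : ℕ, {ω | N ω (above g I k) = 0}) ∩ ({_ω | a ≤ u} ∩ {ω | N ω (above g I u) = 0}))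
        ∪ (⋃ k : ℕ, {ω | N ω (above g I k) = 0})ᶜ := by
    ext ω
    by_cases h : ∃ k : ℕ, N ω (above g I k) = 0
    · have := hN.peak_le_iff_of_bdd hg hI a ω u h
      have h2 : ω ∈ ⋃ k : ℕ, {ω | N ω (above g I k) = 0} := by simpa using h
      simp only [Set.mem_preimage, Set.mem_Iic, this, Set.mem_union, Set.mem_inter_iff, h2,
        true_and, Set.mem_compl_iff, not_true, or_false, Set.mem_ofPred_eq]
    · have := hN.peak_of_not_bdd hg hI a ω h
      have h2 : ω ∉ ⋃ k : ℕ, {ω | N ω (above g I k) = 0} := by simpa using h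
      simp only [Set.mem_preimage, Set.mem_Iic, this, Set.mem_union, Set.mem_inter_iff, h2,
        false_and, Set.mem_compl_iff, not_false_eq_true, or_true, zero_le]
  rw [this]
  exact (hb.inter ((MeasurableSet.const _).inter (hm _))).union hb.compl

lemma IsPoissonPointProcess.measurable_peak (hN : IsPoissonPointProcess P N ν)
    (hg : Measurable g) (hI : MeasurableSet I) (a : ℝ≥0) :
    Measurable (fun ω => peak a g I (N ω)) :=
  (hN.measurable_peak_voidSigma hg hI a (Set.subset_univ _)).mono (hN.voidSigma_le _) le_rfl

variable [IsProbabilityMeasure P]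

/-- The regions above level `k` decrease to the empty set, so their intensities, finite from some
`k` on, tend to 0 and bound the probability of an infinite supremum. -/
lemma IsPoissonPointProcess.ae_bdd (hN : IsPoissonPointProcess P N ν)
    (hg : Measurable g) (hI : MeasurableSet I) (hfin : ∃ k : ℕ, ν (above g I k) ≠ ∞) :
    ∀ᵐ ω ∂P, ∃ k : ℕ, N ω (above g I k) = 0 := by
  have ht : Tendsto (fun k : ℕ => ν (above g I k)) atTop (𝓝 0) := by
    have h0 : ⋂ k : ℕ, above g I k = ∅ := by
      refine Set.eq_empty_of_forall_notMem fun p hp => ?_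
      obtain ⟨k, hk⟩ := exists_nat_ge (p.2 - g p.1)
      linarith [(Set.mem_iInter.1 hp k).2]
    have := tendsto_measure_iInter_atTop (μ := ν) (s := fun k : ℕ => above g I k)
      (fun k => (measurableSet_above hg hI _).nullMeasurableSet)
      (fun k l h => above_anti g I (Nat.cast_le.2 h)) hfin
    rwa [h0, measure_empty] at this
  rw [ae_iff]
  refine le_antisymm (ge_of_tendsto' ht fun k => ?_) zero_le
  refine (measure_mono ?_).trans (hN.prob_ne_zero_le (measurableSet_above hg hI k))
  intro ω hω
  simp only [not_exists, Set.mem_ofPred_eq] at hω ⊢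
  exact hω k

lemma IsPoissonPointProcess.ae_peak_le_iff (hN : IsPoissonPointProcess P N ν)
    (hg : Measurable g) (hI : MeasurableSet I) (hfin : ∃ k : ℕ, ν (above g I k) ≠ ∞) (a : ℝ≥0) :
    ∀ᵐ ω ∂P, ∀ u : ℝ≥0, peak a g I (N ω) ≤ u ↔ a ≤ u ∧ N ω (above g I u) = 0 := by
  filter_upwards [hN.ae_bdd hg hI hfin] with ω h u
  exact hN.peak_le_iff_of_bdd hg hI a ω u h

lemma IsPoissonPointProcess.prob_peak_le (hN : IsPoissonPointProcess P N ν)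
    (hg : Measurable g) (hI : MeasurableSet I) (hfin : ∃ k : ℕ, ν (above g I k) ≠ ∞)
    (a u : ℝ≥0) :
    P {ω | peak a g I (N ω) ≤ u} =
      ENNReal.ofReal (expNeg (ν (above g I u))) * (if a ≤ u then 1 else 0) := by
  have h : {ω | peak a g I (N ω) ≤ u} =ᵐ[P] {ω | a ≤ u ∧ N ω (above g I u) = 0} := by
    filter_upwards [hN.ae_peak_le_iff hg hI hfin a] with ω h
    exact propext (h u)
  rw [measure_congr h]
  split_ifs with ha
  · simp [ha, hN.void_probability (measurableSet_above hg hI u)]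
  · simp [ha]

end Peak

/-! ### Tails of `μ` and intensities of regions. -/

lemma sigmaFinite_of_tail {μ : Measure ℝ} (h0 : μ (Set.Iic 0) = 0)
    (hμ : ∀ x : ℝ, 0 < x → tail μ x < ∞) : SigmaFinite μ := by
  refine ⟨⟨⟨fun n : ℕ => Set.Iic 0 ∪ Set.Ici (1 / ((n : ℝ) + 1)), fun _ => trivial, fun n => ?_,
    ?_⟩⟩⟩
  · refine (measure_union_le _ _).trans_lt ?_
    rw [h0, zero_add]
    exact hμ _ (by positivity)
  · refine Set.eq_univ_of_forall fun x => Set.mem_iUnion.2 ?_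
    rcases le_or_gt x 0 with hx | hx
    · exact ⟨0, Or.inl hx⟩
    · obtain ⟨n, hn⟩ := exists_nat_one_div_lt hx
      exact ⟨n, Or.inr hn.le⟩

section Tail

variable {μ : Measure ℝ}

lemma tail_antitone (μ : Measure ℝ) : Antitone (tail μ) :=
  fun _ _ h => measure_mono (Set.Ici_subset_Ici.2 h)

lemma strictTail_le_tail (μ : Measure ℝ) (x : ℝ) : strictTail μ x ≤ tail μ x :=
  measure_mono Set.Ioi_subset_Ici_self

@[fun_prop]
lemma measurable_tail (μ : Measure ℝ) : Measurable (tail μ) := (tail_antitone μ).measurable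

lemma strictTail_eq_tail {x : ℝ} (h : μ {x} = 0) : strictTail μ x = tail μ x := by
  refine le_antisymm (strictTail_le_tail μ x) ?_
  rw [tail, strictTail, ← Set.Ioi_insert, Set.insert_eq]
  exact (measure_union_le _ _).trans (by simp [h])

lemma countable_atoms (μ : Measure ℝ) [SFinite μ] : {x | μ {x} ≠ 0}.Countable := by
  have := Measure.countable_meas_level_set_pos (μ := μ) (g := id) measurable_id
  refine this.mono fun x hx => ?_
  simpa [pos_iff_ne_zero] using hx

/-- Fubini: the section at time `r` is the open half-line beyond `u + g r`. -/
lemma intensity_above [SFinite μ] {g : ℝ → ℝ} (hg : Measurable g) {I : Set ℝ}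
    (hI : MeasurableSet I) (hI0 : I ⊆ Set.Ici 0) (u : ℝ) :
    intensity μ (above g I u) = ∫⁻ r in I, strictTail μ (u + g r) := by
  rw [intensity, Measure.prod_apply (measurableSet_above hg hI u)]
  have : (fun r => μ (Prod.mk r ⁻¹' above g I u)) =
      I.indicator (fun r => strictTail μ (u + g r)) := by
    ext r
    by_cases hr : r ∈ I
    · rw [Set.indicator_of_mem hr]
      congr 1
      ext ξ
      simp [above, hr]
    · rw [Set.indicator_of_notMem hr]
      convert measure_empty (μ := μ)
      ext ξ
      simp [above, hr]
  rw [this, lintegral_indicator hI, Measure.restrict_restrict hI,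
    Set.inter_eq_self_of_subset_left hI0]

lemma exists_intensity_above_ne_top [SFinite μ] (hμ : ∀ x : ℝ, 0 < x → tail μ x < ∞)
    {g : ℝ → ℝ} (hg : Measurable g) {I : Set ℝ} (hI : MeasurableSet I) {T C : ℝ}
    (hIT : I ⊆ Set.Icc 0 T) (hC : ∀ r ∈ I, C ≤ g r) :
    ∃ k : ℕ, intensity μ (above g I k) ≠ ∞ := by
  -- With `k + C > 0` the whole region lies above a positive level, where the tail is finite.
  obtain ⟨k, hk⟩ := exists_nat_gt (-C)
  refine ⟨k, ?_⟩
  rw [intensity_above hg hI (hIT.trans Set.Icc_subset_Ici_self)]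
  refine ne_top_of_le_ne_top (b := ∫⁻ _ in I, tail μ (k + C)) ?_ (setLIntegral_mono' hI ?_)
  · rw [setLIntegral_const]
    refine ENNReal.mul_ne_top (hμ _ (by linarith)).ne ?_
    refine ne_top_of_le_ne_top ?_ (measure_mono hIT)
    simp
  · intro r hr
    exact (strictTail_le_tail μ _).trans (tail_antitone μ (by linarith [hC r hr]))

lemma intensity_fiber_eq_zero [SFinite μ] (t : ℝ) :
    intensity μ ({t} ×ˢ Set.univ) = 0 := by
  rw [intensity, Measure.prod_prod]
  have : volume.restrict (Set.Ici (0 : ℝ)) {t} = 0 := by simp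
  rw [this, zero_mul]

lemma lintegral_strictTail_eq_tail {f : ℝ → ℝ} {I : Set ℝ}
    (h : ∀ᵐ r ∂(volume.restrict I), μ {f r} = 0) :
    ∫⁻ r in I, strictTail μ (f r) = ∫⁻ r in I, tail μ (f r) :=
  lintegral_congr_ae (h.mono fun _ hr => strictTail_eq_tail hr)

/-- A piecewise affine function with slope `-b ≠ 0` hits the atoms of `μ` only on a null set. -/
lemma ae_apply_not_atom [SFinite μ] {b : ℝ} (hb : b ≠ 0) {ι : Type*} [Finite ι] (c : ι → ℝ)
    {f : ℝ → ℝ} (hf : ∀ r, ∃ j, f r = c j - b * r) : ∀ᵐ r, μ {f r} = 0 := by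
  -- The exceptional times are countable: preimages of the atoms under finitely many injective
  -- affine maps.
  have hc : (⋃ j, (fun r : ℝ => c j - b * r) ⁻¹' {x | μ {x} ≠ 0}).Countable := by
    refine Set.countable_iUnion fun j => (countable_atoms μ).preimage ?_
    intro r r' h
    have : b * r = b * r' := by simpa using h
    exact mul_left_cancel₀ hb this
  rw [ae_iff]
  refine measure_mono_null (fun r hr => ?_) (hc.measure_zero volume)
  obtain ⟨j, hj⟩ := hf r
  refine Set.mem_iUnion.2 ⟨j, ?_⟩
  simpa [hj] using hr

end Tail

/-! ### One-dimensional and finite-dimensional laws. -/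

lemma atoms_dirac_add (q : ℝ × ℝ) (m : Measure (ℝ × ℝ)) :
    atoms (Measure.dirac q + m) = insert q (atoms m) := by
  ext p
  by_cases h : p = q
  · simp [atoms, h]
  · have h' : q ≠ p := fun e => h e.symm
    simp [atoms, h, h']

/-- The loss `b (t - s)` at time `t` of an atom at time `s`. -/
def decay (b t : ℝ) (s : ℝ) : ℝ := b * (t - s)

@[fun_prop]
lemma measurable_decay (b t : ℝ) : Measurable (decay b t) := by unfold decay; fun_prop

section Esn

variable {Ω : Type*} {b : ℝ} {N : Ω → Measure (ℝ × ℝ)}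

/-- The atom `(0, x)` contributes the constant `(x - bt)₊`, which separates the starting point from
the noise. -/
lemma esn_eq_peak (b : ℝ) (N : Ω → Measure (ℝ × ℝ)) (x t : ℝ≥0) (ω : Ω) :
    esn b N x t ω = peak (Real.toNNReal (x - b * t)) (decay b t) (Set.Icc 0 (t : ℝ)) (N ω) := by
  rw [esn, peak, atoms_dirac_add]
  congr 1
  ext z
  simp only [Set.mem_ofPred_eq, Set.mem_insert_iff, Set.mem_Icc, decay]
  constructor
  · rintro ⟨p, rfl | hp, h1, h2, rfl⟩
    · simp
    · exact Or.inr ⟨p, hp, ⟨h1, h2⟩, rfl⟩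
  · rintro (rfl | ⟨p, hp, ⟨h1, h2⟩, rfl⟩)
    · exact ⟨_, Or.inl rfl, by simp⟩
    · exact ⟨p, Or.inr hp, h1, h2, rfl⟩

variable [MeasurableSpace Ω] {P : Measure Ω} {μ : Measure ℝ}

lemma measurable_esn (hN : IsPoissonPointProcess P N (intensity μ)) (b : ℝ) (x t : ℝ≥0) :
    Measurable (esn b N x t) := by
  have : esn b N x t = fun ω =>
      peak (Real.toNNReal (x - b * t)) (decay b t) (Set.Icc 0 (t : ℝ)) (N ω) :=
    funext (esn_eq_peak b N x t)
  rw [this]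
  exact hN.measurable_peak (measurable_decay b t) measurableSet_Icc _

lemma measurable_esn_voidSigma (hN : IsPoissonPointProcess P N (intensity μ)) (b : ℝ)
    (x : ℝ≥0) {r t : ℝ≥0} (h : r ≤ t) :
    Measurable[voidSigma N (Set.Iic (t : ℝ) ×ˢ Set.univ)] (esn b N x r) := by
  have : esn b N x r = fun ω =>
      peak (Real.toNNReal (x - b * r)) (decay b r) (Set.Icc 0 (r : ℝ)) (N ω) :=
    funext (esn_eq_peak b N x r)
  rw [this]
  refine hN.measurable_peak_voidSigma (measurable_decay b r) measurableSet_Icc _ ?_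
  exact Set.prod_mono (fun s hs => hs.2.trans (by exact_mod_cast h)) le_rfl

variable [IsProbabilityMeasure P] [SFinite μ]

lemma exists_above_decay_ne_top (hμ : ∀ x : ℝ, 0 < x → tail μ x < ∞) (b T t : ℝ) {I : Set ℝ}
    (hI : MeasurableSet I) (hIt : I ⊆ Set.Icc 0 T) :
    ∃ k : ℕ, intensity μ (above (decay b t) I k) ≠ ∞ := by
  -- For `0 ≤ r ≤ T` one has `b(t - r) ≥ bt - |b|T`, whatever the sign of `b`.
  refine exists_intensity_above_ne_top hμ (measurable_decay b t) hI (C := b * t - |b| * T) hIt ?_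
  intro r hr
  have h1 := hIt hr
  have h3 : |b * r| ≤ |b| * T := by
    rw [abs_mul, abs_of_nonneg h1.1]
    exact mul_le_mul_of_nonneg_left h1.2 (abs_nonneg b)
  have := le_abs_self (b * r)
  simp only [decay]
  nlinarith

lemma ae_esn_le_iff (hN : IsPoissonPointProcess P N (intensity μ))
    (hμ : ∀ x : ℝ, 0 < x → tail μ x < ∞) (b : ℝ) (x t : ℝ≥0) :
    ∀ᵐ ω ∂P, ∀ u : ℝ≥0, esn b N x t ω ≤ u ↔
      Real.toNNReal (x - b * t) ≤ u ∧ N ω (above (decay b t) (Set.Icc 0 (t : ℝ)) u) = 0 := by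
  simp only [esn_eq_peak]
  exact hN.ae_peak_le_iff (measurable_decay b t) measurableSet_Icc
    (exists_above_decay_ne_top hμ b t t measurableSet_Icc subset_rfl) _

lemma prob_esn_le (hN : IsPoissonPointProcess P N (intensity μ))
    (hμ : ∀ x : ℝ, 0 < x → tail μ x < ∞) (b : ℝ) (x t u : ℝ≥0) :
    P {ω | esn b N x t ω ≤ u} =
      ENNReal.ofReal (expNeg (∫⁻ r in Set.Ioc (0 : ℝ) t, strictTail μ (u + b * (t - r)))) *
        (if Real.toNNReal (x - b * t) ≤ u then 1 else 0) := by
  simp only [esn_eq_peak]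
  rw [hN.prob_peak_le (measurable_decay b t) measurableSet_Icc
    (exists_above_decay_ne_top hμ b t t measurableSet_Icc subset_rfl),
    intensity_above (measurable_decay b t) measurableSet_Icc Set.Icc_subset_Ici_self,
    setLIntegral_congr Ioc_ae_eq_Icc.symm]
  rfl

lemma real_prob_esn_le (hN : IsPoissonPointProcess P N (intensity μ))
    (hμ : ∀ x : ℝ, 0 < x → tail μ x < ∞) (b : ℝ) (x t : ℝ≥0) (u : ℝ) :
    P.real {ω | (esn b N x t ω : ℝ) ≤ u} =
      expNeg (∫⁻ r in Set.Ioc (0 : ℝ) t, strictTail μ (u + b * (t - r))) *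
        (if max ((x : ℝ) - b * t) 0 ≤ u then 1 else 0) := by
  rcases lt_or_ge u 0 with hu | hu
  · have h1 : {ω | (esn b N x t ω : ℝ) ≤ u} = ∅ :=
      Set.eq_empty_of_forall_notMem fun ω h => (hu.trans_le (esn b N x t ω).2).not_ge h
    have h2 : ¬ max ((x : ℝ) - b * t) 0 ≤ u := fun h => by
      linarith [le_max_right ((x : ℝ) - b * t) 0]
    simp [h1, h2]
  · lift u to ℝ≥0 using hu
    have h3 : (Real.toNNReal (x - b * t) ≤ u) ↔ max ((x : ℝ) - b * t) 0 ≤ u := by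
      rw [← NNReal.coe_le_coe, Real.coe_toNNReal']
    simp only [NNReal.coe_le_coe]
    rw [Measure.real, prob_esn_le hN hμ, ENNReal.toReal_mul,
      ENNReal.toReal_ofReal (expNeg_nonneg _)]
    simp only [h3]
    split_ifs <;> simp

/-- The constraint at each time forbids one region `A i`. The sets `B i` cut the union of the `A i`
into disjoint time slices: in slice `i` exactly the lines with `j ≥ i` are active, and being above
one of them means being above their minimum. Only the null fibre at time 0 is lost. -/
lemma fdd_esn (hN : IsPoissonPointProcess P N (intensity μ))
    (hμ : ∀ x : ℝ, 0 < x → tail μ x < ∞) (b : ℝ) {n : ℕ} (s : Fin (n + 1) → ℝ≥0)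
    (u : Fin n → ℝ≥0) (hs0 : s 0 = 0) (hs : StrictMono s) :
    P.real {ω | ∀ i : Fin n, esn b N 0 (s i.succ) ω ≤ u i} =
      expNeg (fddExponent (strictTail μ) b s u) *
        ∏ i : Fin n, (if max (-b * (s i.succ : ℝ)) 0 ≤ (u i : ℝ) then (1 : ℝ) else 0) := by
  set A : Fin n → Set (ℝ × ℝ) := fun i =>
    above (decay b (s i.succ)) (Set.Icc 0 (s i.succ : ℝ)) (u i) with hA
  have hAm : ∀ i, MeasurableSet (A i) := fun i =>
    measurableSet_above (measurable_decay _ _) measurableSet_Icc _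
  let m : Fin n → ℝ → ℝ := fun i t => (Finset.Ici i).inf' ⟨i, Finset.mem_Ici.2 le_rfl⟩
      (fun j => (u j : ℝ) + b * ((s j.succ : ℝ) - t))
  have hmlt : ∀ i t y, m i t < y ↔
      ∃ j ∈ Finset.Ici i, (u j : ℝ) + b * ((s j.succ : ℝ) - t) < y := fun i t y =>
    Finset.inf'_lt_iff _
  have hmm : ∀ i, Measurable (m i) := fun i =>
    (Continuous.finset_inf'_apply _ fun j _ => by fun_prop).measurable
  set B : Fin n → Set (ℝ × ℝ) := fun i =>
    above (m i) (Set.Ioc (s i.castSucc : ℝ) (s i.succ : ℝ)) 0 with hB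
  have hBm : ∀ i, MeasurableSet (B i) := fun i =>
    measurableSet_above (hmm i) measurableSet_Ioc _
  have hBA : ⋃ i, B i ⊆ ⋃ i, A i := by
    rintro p hp
    obtain ⟨i, ⟨h1, h2⟩, h3⟩ := Set.mem_iUnion.1 hp
    rw [zero_add, hmlt] at h3
    obtain ⟨j, hj, h3⟩ := h3
    refine Set.mem_iUnion.2 ⟨j, ⟨(NNReal.coe_nonneg _).trans h1.le, h2.trans ?_⟩, h3⟩
    exact_mod_cast hs.monotone (Fin.succ_le_succ_iff.2 (Finset.mem_Ici.1 hj))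
  have hAB : ⋃ i, A i ⊆ (⋃ i, B i) ∪ {0} ×ˢ Set.univ := by
    rintro p hp
    obtain ⟨j, ⟨h1, h2⟩, h3⟩ := Set.mem_iUnion.1 hp
    rcases h1.eq_or_lt with h1 | h1
    · exact Or.inr ⟨h1.symm, trivial⟩
    refine Or.inl (Set.mem_iUnion.2 ?_)
    -- The least such `i` indexes the slice containing `p.1`. Minimality gives its left endpoint,
    -- except for `i = 0`, where `s 0 = 0 < p.1` is used.
    obtain ⟨i, hi, hmin⟩ : ∃ i : Fin n, p.1 ≤ s i.succ ∧ ∀ k < i, ¬ p.1 ≤ s k.succ := by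
      classical
      have hne : (Finset.univ.filter fun i : Fin n => p.1 ≤ s i.succ).Nonempty :=
        ⟨j, by simp [h2]⟩
      refine ⟨_, (Finset.mem_filter.1 (Finset.min'_mem _ hne)).2, fun k hk hk' => ?_⟩
      exact (Finset.min'_le _ k (by simp [hk'])).not_gt hk
    have hij : i ≤ j := by
      by_contra h
      exact hmin j (not_le.1 h) h2
    refine ⟨i, ⟨?_, hi⟩, ?_⟩
    · rcases Nat.eq_zero_or_pos i.1 with h | h
      · have : i.castSucc = 0 := Fin.ext h
        rw [this, hs0]
        exact h1
      · have hlt : i.1 - 1 < n := by omega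
        have := hmin ⟨i.1 - 1, hlt⟩ (Fin.lt_def.2 (by simp; omega))
        have h4 : (⟨i.1 - 1, hlt⟩ : Fin n).succ = i.castSucc := Fin.ext (by simp; omega)
        rw [h4] at this
        exact not_le.1 this
    · rw [zero_add, hmlt]
      exact ⟨j, Finset.mem_Ici.2 hij, h3⟩
  have hν : intensity μ (⋃ i, A i) = fddExponent (strictTail μ) b s u := by
    have h1 : intensity μ (⋃ i, A i) = intensity μ (⋃ i, B i) := by
      refine le_antisymm ((measure_mono hAB).trans ((measure_union_le _ _).trans ?_))
        (measure_mono hBA)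
      rw [intensity_fiber_eq_zero, add_zero]
    have hdisj : Pairwise (Function.onFun Disjoint B) := by
      have key : ∀ i k : Fin n, i < k → Disjoint (B i) (B k) := by
        intro i k hik
        refine Set.disjoint_left.2 fun p hp hp' => ?_
        have : (s i.succ : ℝ) ≤ s k.castSucc := by
          exact_mod_cast hs.monotone (Fin.le_def.2 (by simpa using hik))
        exact (hp.1.2.trans this).not_gt hp'.1.1
      intro i k hik
      rcases lt_or_gt_of_ne hik with h | h
      · exact key i k h
      · exact (key k i h).symm
    rw [h1, measure_iUnion hdisj hBm, tsum_fintype, fddExponent]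
    refine Finset.sum_congr rfl fun i _ => ?_
    rw [hB, intensity_above (hmm i) measurableSet_Ioc]
    · simp only [zero_add, m]
    · exact fun r hr => (NNReal.coe_nonneg _).trans hr.1.le
  have hev : {ω | ∀ i : Fin n, esn b N 0 (s i.succ) ω ≤ u i} =ᵐ[P]
      {ω | (∀ i : Fin n, max (-b * (s i.succ : ℝ)) 0 ≤ (u i : ℝ)) ∧ N ω (⋃ i, A i) = 0} := by
    have hall : ∀ᵐ ω ∂P, ∀ i : Fin n, ∀ u : ℝ≥0, esn b N 0 (s i.succ) ω ≤ u ↔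
        Real.toNNReal ((0 : ℝ≥0) - b * s i.succ) ≤ u ∧
          N ω (above (decay b (s i.succ)) (Set.Icc 0 (s i.succ : ℝ)) u) = 0 :=
      ae_all_iff.2 fun i => ae_esn_le_iff hN hμ b 0 (s i.succ)
    filter_upwards [hall] with ω hω
    refine propext ?_
    change (∀ i, _) ↔ _ ∧ _
    simp only [hω, forall_and, measure_iUnion_null_iff, hA]
    refine and_congr_left' (forall_congr' fun i => ?_)
    rw [← NNReal.coe_le_coe, Real.coe_toNNReal', NNReal.coe_zero, zero_sub, neg_mul]
  rw [measureReal_congr hev]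
  by_cases hc : ∀ i : Fin n, max (-b * (s i.succ : ℝ)) 0 ≤ (u i : ℝ)
  · rw [Finset.prod_eq_one (fun i _ => if_pos (hc i)), mul_one, ← hν,
      ← hN.void_probability_real (MeasurableSet.iUnion hAm)]
    congr 1
    ext ω
    exact and_iff_right hc
  · have : ∃ i : Fin n, ¬ max (-b * (s i.succ : ℝ)) 0 ≤ (u i : ℝ) := not_forall.1 hc
    obtain ⟨i, hi⟩ := this
    rw [Finset.prod_eq_zero (Finset.mem_univ i) (if_neg hi), mul_zero]
    simp only [hc, false_and]
    simp

/-- A minimum of finitely many lines of slope `-b` is attained by one of them at each time. -/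
lemma fddExponent_strictTail_eq_tail {b : ℝ} (h : b ≠ 0 ∨ ∀ x, μ {x} = 0) {n : ℕ}
    (s : Fin (n + 1) → ℝ≥0) (u : Fin n → ℝ≥0) :
    fddExponent (strictTail μ) b s u = fddExponent (tail μ) b s u := by
  refine Finset.sum_congr rfl fun i _ => lintegral_strictTail_eq_tail ?_
  rcases h with hb | h
  · refine ae_restrict_of_ae (ae_apply_not_atom hb
      (fun j : Fin n => (u j : ℝ) + b * (s j.succ : ℝ)) fun r => ?_)
    obtain ⟨j, -, hj⟩ := Finset.exists_mem_eq_inf' (s := Finset.Ici i)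
      ⟨i, Finset.mem_Ici.2 le_rfl⟩ (fun j => (u j : ℝ) + b * ((s j.succ : ℝ) - r))
    exact ⟨j, by rw [hj]; ring⟩
  · exact Eventually.of_forall fun r => h _

lemma lintegral_decay_strictTail_eq_tail {b : ℝ} (h : b ≠ 0 ∨ ∀ x, μ {x} = 0) (u t : ℝ)
    (I : Set ℝ) :
    ∫⁻ r in I, strictTail μ (u + b * (t - r)) = ∫⁻ r in I, tail μ (u + b * (t - r)) := by
  refine lintegral_strictTail_eq_tail ?_
  rcases h with hb | h
  · exact ae_restrict_of_ae (ae_apply_not_atom hb (fun _ : Unit => u + b * t)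
      fun r => ⟨(), by ring⟩)
  · exact Eventually.of_forall fun r => h _

end Esn

/-! ### Changes of variables and the freezing lemma. -/

/-- Substitution `y = c + a r` in a set integral. -/
lemma lintegral_comp_affine {a : ℝ} (ha : a ≠ 0) (c : ℝ) (f : ℝ → ℝ≥0∞) {I J : Set ℝ}
    (hI : MeasurableSet I) (hJ : (fun r : ℝ => c + a * r) '' I = J) :
    ∫⁻ r in I, f (c + a * r) = ENNReal.ofReal (1 / |a|) * ∫⁻ y in J, f y := by
  have h := lintegral_image_eq_lintegral_abs_deriv_mul (s := I) (f := fun r => c + a * r)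
    (f' := fun _ => a) hI (fun x _ => by
      simpa using (((hasDerivAt_id x).const_mul a).const_add c).hasDerivWithinAt)
    (fun x _ y _ hxy => by simpa [ha] using hxy) f
  rw [hJ] at h
  rw [h, lintegral_const_mul' _ _ ENNReal.ofReal_ne_top, ← mul_assoc,
    ← ENNReal.ofReal_mul (by positivity), one_div, inv_mul_cancel₀ (abs_ne_zero.2 ha)]
  simp

/-- For `b < 0` the image interval lies to the left of `u`; the unoriented interval and `|b|` cover
both signs. -/
lemma lintegral_tail_decay {b : ℝ} (hb : b ≠ 0) (f : ℝ → ℝ≥0∞) (u : ℝ) (t : ℝ≥0) :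
    ∫⁻ r in Set.Ioc (0 : ℝ) t, f (u + b * (t - r)) =
      ENNReal.ofReal (1 / |b|) * ∫⁻ y in Set.uIoc u (u + b * t), f y := by
  have h := lintegral_comp_affine (neg_ne_zero.2 hb) (u + b * t) f
    (measurableSet_Icc (a := (0 : ℝ)) (b := t)) rfl
  rw [abs_neg] at h
  rw [setLIntegral_congr Ioc_ae_eq_Icc]
  have h2 : ∀ r : ℝ, u + b * (t - r) = u + b * t + -b * r := fun r => by ring
  simp only [h2]
  rw [h]
  have h3 : (fun r : ℝ => u + b * t + -b * r) '' Set.Icc 0 t = Set.uIcc u (u + b * t) := by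
    have h4 : (fun r : ℝ => u + b * t + -b * r) =
        (fun y => (u + b * t) + y) ∘ (fun r => -b * r) := rfl
    rw [h4, Set.image_comp, ← Set.uIcc_of_le t.coe_nonneg, Set.image_const_mul_uIcc,
      Set.image_const_add_uIcc, Set.uIcc_comm]
    congr 1 <;> simp
  rw [h3]
  congr 1
  refine setLIntegral_congr ?_
  rw [Set.uIcc, Set.uIoc]
  exact Ioc_ae_eq_Icc.symm

/-- Freezing lemma: conditionally on `m`, an `m`-measurable `X` is a constant and an independent
`Z` keeps its law. -/
lemma condExp_apply_pair_of_indep {Ω : Type*} {m : MeasurableSpace Ω} [mΩ : MeasurableSpace Ω]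
    {P : Measure Ω} [IsProbabilityMeasure P] (hm : m ≤ mΩ) {α β : Type*} [MeasurableSpace α]
    [MeasurableSpace β] {X : Ω → α} {Z : Ω → β} (hX : Measurable[m] X) (hZ : Measurable Z)
    (hind : Indep m (MeasurableSpace.comap Z inferInstance) P) {F : α × β → ℝ}
    (hF : Measurable F) {C : ℝ} (hC : ∀ p, |F p| ≤ C) :
    P[fun ω => F (X ω, Z ω) | m] =ᵐ[P] fun ω => ∫ z, F (X ω, z) ∂(P.map Z) := by
  have hX' : Measurable X := hX.mono hm le_rfl
  have : IsProbabilityMeasure (P.map Z) := Measure.isProbabilityMeasure_map hZ.aemeasurable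
  have hG : Measurable fun x => ∫ z, F (x, z) ∂(P.map Z) :=
    (hF.stronglyMeasurable.integral_prod_right').measurable
  have hFint : Integrable (fun ω => F (X ω, Z ω)) P :=
    Integrable.of_bound (hF.comp (hX'.prodMk hZ)).aestronglyMeasurable C
      (Eventually.of_forall fun ω => hC _)
  have hGint : Integrable (fun ω => ∫ z, F (X ω, z) ∂(P.map Z)) P := by
    refine Integrable.of_bound (hG.comp hX').aestronglyMeasurable C
      (Eventually.of_forall fun ω => ?_)
    refine (norm_integral_le_of_norm_le_const (C := C) (Eventually.of_forall fun z => hC _)).trans ?_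
    simp
  symm
  refine ae_eq_condExp_of_forall_setIntegral_eq hm hFint (fun _ _ _ => hGint.integrableOn) ?_
    ((hG.comp hX).stronglyMeasurable.aestronglyMeasurable)
  intro A hA _
  -- Carrying the indicator of `A` along with `X` turns an integral over `A` into an integral
  -- against the product law of `(W, Z)`.
  let W : Ω → ℝ × α := fun ω => (A.indicator (fun _ => 1) ω, X ω)
  have hW : Measurable[m] W := ((@measurable_const _ _ _ m (1 : ℝ)).indicator hA).prodMk hX
  have hW' : Measurable W := hW.mono hm le_rfl
  have hWZ : IndepFun W Z P := indep_of_indep_of_le_left hind (measurable_iff_comap_le.1 hW)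
  let H : (ℝ × α) × β → ℝ := fun p => p.1.1 * F (p.1.2, p.2)
  have hH : Measurable H := by
    have : Measurable fun p : (ℝ × α) × β => F (p.1.2, p.2) := hF.comp (by fun_prop)
    exact (by fun_prop : Measurable fun p : (ℝ × α) × β => p.1.1).mul this
  have hHW : ∀ ω, H (W ω, Z ω) = A.indicator (fun ω => F (X ω, Z ω)) ω := by
    intro ω
    by_cases h : ω ∈ A <;> simp [H, W, h]
  have hmap := (indepFun_iff_map_prod_eq_prod_map_map hW'.aemeasurable hZ.aemeasurable).1 hWZ
  have hHint : Integrable H ((P.map W).prod (P.map Z)) := by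
    rw [← hmap, integrable_map_measure hH.aestronglyMeasurable (hW'.prodMk hZ).aemeasurable]
    exact (hFint.indicator (hm _ hA)).congr (Eventually.of_forall fun ω => (hHW ω).symm)
  have : IsProbabilityMeasure (P.map W) := Measure.isProbabilityMeasure_map hW'.aemeasurable
  have h1 : ∫ p, H p ∂((P.map W).prod (P.map Z)) = ∫ ω in A, F (X ω, Z ω) ∂P := by
    rw [← hmap, integral_map (hW'.prodMk hZ).aemeasurable hH.aestronglyMeasurable,
      ← integral_indicator (hm _ hA)]
    exact integral_congr_ae (Eventually.of_forall hHW)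
  rw [← h1, integral_prod _ hHint, integral_map hW'.aemeasurable
    (hH.stronglyMeasurable.integral_prod_right').aestronglyMeasurable,
    ← integral_indicator (hm _ hA)]
  refine integral_congr_ae (Eventually.of_forall fun ω => ?_)
  by_cases h : ω ∈ A <;> simp [H, W, h]

/-! ### Markov and Feller properties. -/

section Markov

variable {Ω : Type*} [MeasurableSpace Ω] {P : Measure Ω} {μ : Measure ℝ} {b : ℝ}
  {N : Ω → Measure (ℝ × ℝ)}

/-- The law of the contribution of the atoms of a time interval of length `t` at its end. -/
def noiseLaw (P : Measure Ω) (b : ℝ) (N : Ω → Measure (ℝ × ℝ)) (t : ℝ≥0) : Measure ℝ≥0 :=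
  P.map (fun ω => peak 0 (decay b t) (Set.Ioc 0 (t : ℝ)) (N ω))

variable [IsProbabilityMeasure P]

lemma isProbabilityMeasure_noiseLaw (hN : IsPoissonPointProcess P N (intensity μ)) (b : ℝ)
    (t : ℝ≥0) : IsProbabilityMeasure (noiseLaw P b N t) :=
  Measure.isProbabilityMeasure_map
    (hN.measurable_peak (measurable_decay b t) measurableSet_Ioc 0).aemeasurable

lemma isProbabilityMeasure_esnLaw (hN : IsPoissonPointProcess P N (intensity μ)) (b : ℝ)
    (t x : ℝ≥0) : IsProbabilityMeasure (esnLaw P b N t x) :=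
  Measure.isProbabilityMeasure_map (measurable_esn hN b x t).aemeasurable

lemma indep_esn_past_peak (hN : IsPoissonPointProcess P N (intensity μ)) (b : ℝ) (t : ℝ≥0)
    (s : ℝ) :
    Indep (voidSigma N (Set.Iic (t : ℝ) ×ˢ Set.univ)) (MeasurableSpace.comap
      (fun ω => peak 0 (decay b s) (Set.Ioc (t : ℝ) s) (N ω)) inferInstance) P := by
  have hd : Disjoint (Set.Iic (t : ℝ) ×ˢ (Set.univ : Set ℝ)) (Set.Ioi (t : ℝ) ×ˢ Set.univ) := by
    refine Set.disjoint_left.2 fun p hp hp' => ?_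
    exact not_lt.2 (Set.mem_Iic.1 hp.1) (Set.mem_Ioi.1 hp'.1)
  refine indep_of_indep_of_le_right (hN.indep_voidSigma hd) (measurable_iff_comap_le.1 ?_)
  exact hN.measurable_peak_voidSigma (measurable_decay b s) measurableSet_Ioc 0
    (Set.prod_mono Set.Ioc_subset_Ioi_self le_rfl)

variable [SFinite μ]

lemma noiseLaw_Iic (hN : IsPoissonPointProcess P N (intensity μ))
    (hμ : ∀ x : ℝ, 0 < x → tail μ x < ∞) (b : ℝ) (t u : ℝ≥0) :
    noiseLaw P b N t (Set.Iic u) =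
      ENNReal.ofReal (expNeg (∫⁻ r in Set.Ioc (0 : ℝ) t, strictTail μ (u + b * (t - r)))) := by
  have h := hN.prob_peak_le (measurable_decay b t) measurableSet_Ioc
    (exists_above_decay_ne_top hμ b t t measurableSet_Ioc Set.Ioc_subset_Icc_self) 0 u
  rw [if_pos zero_le, mul_one, intensity_above (measurable_decay b t) measurableSet_Ioc
    (fun r hr => hr.1.le)] at h
  rw [noiseLaw, Measure.map_apply (hN.measurable_peak (measurable_decay b t) measurableSet_Ioc 0)
    measurableSet_Iic]
  exact h

/-- Time homogeneity: Lebesgue measure is translation invariant, so the two distribution functions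
agree. -/
lemma map_peak_shift (hN : IsPoissonPointProcess P N (intensity μ))
    (hμ : ∀ x : ℝ, 0 < x → tail μ x < ∞) (b : ℝ) (t s : ℝ≥0) :
    P.map (fun ω => peak 0 (decay b (t + s)) (Set.Ioc (t : ℝ) (t + s)) (N ω)) =
      noiseLaw P b N s := by
  have hm := hN.measurable_peak (measurable_decay b (t + s))
    (measurableSet_Ioc (a := (t : ℝ)) (b := t + s)) 0
  have := isProbabilityMeasure_noiseLaw hN b s
  have := Measure.isProbabilityMeasure_map (μ := P) hm.aemeasurable
  refine Measure.ext_of_Iic _ _ fun u => ?_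
  have hsub : Set.Ioc (t : ℝ) (t + s) ⊆ Set.Icc 0 (t + s) :=
    fun r hr => ⟨t.coe_nonneg.trans hr.1.le, hr.2⟩
  have h := hN.prob_peak_le (measurable_decay b (t + s)) measurableSet_Ioc
    (exists_above_decay_ne_top hμ b (t + s) (t + s) measurableSet_Ioc hsub) 0 u
  rw [if_pos zero_le, mul_one, intensity_above (measurable_decay b (t + s)) measurableSet_Ioc
    (fun r hr => (hsub hr).1)] at h
  rw [Measure.map_apply hm measurableSet_Iic, noiseLaw_Iic hN hμ]
  refine h.trans ?_
  congr 2
  have hsh := lintegral_comp_affine one_ne_zero (t : ℝ)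
    (fun y => strictTail μ (u + b * (t + s - y))) (measurableSet_Ioc (a := (0 : ℝ)) (b := s))
    (J := Set.Ioc (t : ℝ) (t + s)) (by simp [add_comm (s : ℝ) (t : ℝ)])
  simp only [abs_one, div_one, ENNReal.ofReal_one, one_mul] at hsh
  simp only [decay]
  rw [← hsh]
  refine lintegral_congr fun r => ?_
  ring_nf

/-- Between `t` and `t + s` every atom already present loses the same amount `bs`, so being below
`u` at time `t + s` is being below `u + bs` at time `t`. -/
lemma ae_esn_add (hN : IsPoissonPointProcess P N (intensity μ))
    (hμ : ∀ x : ℝ, 0 < x → tail μ x < ∞) (b : ℝ) (x t s : ℝ≥0) :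
    ∀ᵐ ω ∂P, esn b N x (t + s) ω = max (Real.toNNReal (esn b N x t ω - b * s))
      (peak 0 (decay b (t + s)) (Set.Ioc (t : ℝ) (t + s)) (N ω)) := by
  have hsub : Set.Ioc (t : ℝ) (t + s) ⊆ Set.Icc 0 (t + s) :=
    fun r hr => ⟨t.coe_nonneg.trans hr.1.le, hr.2⟩
  filter_upwards [ae_esn_le_iff hN hμ b x t, ae_esn_le_iff hN hμ b x (t + s),
    hN.ae_peak_le_iff (measurable_decay b (t + s)) measurableSet_Ioc
      (exists_above_decay_ne_top hμ b (t + s) (t + s) measurableSet_Ioc hsub) 0] with ω h1 h2 h3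
  refine eq_of_forall_ge_iff fun u => ?_
  have hsplit : above (decay b (t + s)) (Set.Icc 0 ((t : ℝ) + s)) u =
      above (decay b t) (Set.Icc 0 (t : ℝ)) (u + b * s) ∪
        above (decay b (t + s)) (Set.Ioc (t : ℝ) (t + s)) u := by
    have hI : Set.Icc 0 ((t : ℝ) + s) = Set.Icc 0 (t : ℝ) ∪ Set.Ioc (t : ℝ) (t + s) := by
      rw [Set.Icc_union_Ioc_eq_Icc t.coe_nonneg (by simp)]
    ext p
    have h : (u : ℝ) + b * s + decay b t p.1 = u + decay b (t + s) p.1 := by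
      simp only [decay]; ring
    simp only [above, Set.mem_ofPred_eq, Set.mem_union, hI, h]
    tauto
  rw [h2, max_le_iff, h3, NNReal.coe_add, hsplit, measure_union_null_iff,
    Real.toNNReal_le_iff_le_coe, Real.toNNReal_le_iff_le_coe]
  simp only [zero_le, true_and]
  rw [← and_assoc]
  refine and_congr_left' ?_
  -- When `b < 0` the shifted level may be negative and so is no level for `h1`; then both sides
  -- fail, since `x` and `M(t)` are nonnegative.
  rcases lt_or_ge ((u : ℝ) + b * s) 0 with hu | hu
  · refine iff_of_false (fun h => ?_) (fun h => ?_)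
    · have hb : b ≤ 0 := by
        by_contra hb
        have := mul_nonneg (not_le.1 hb).le s.coe_nonneg
        linarith [u.coe_nonneg]
      have := mul_nonpos_of_nonpos_of_nonneg hb t.coe_nonneg
      linarith [h.1, x.coe_nonneg]
    · linarith [(esn b N x t ω).coe_nonneg]
  · obtain ⟨v, hv⟩ : ∃ v : ℝ≥0, (v : ℝ) = u + b * s := ⟨⟨_, hu⟩, rfl⟩
    have h4 := h1 v
    rw [Real.toNNReal_le_iff_le_coe, ← NNReal.coe_le_coe, hv] at h4
    rw [sub_le_iff_le_add (a := (esn b N x t ω : ℝ)), h4]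
    refine and_congr_left' ?_
    constructor <;> intro h <;> linarith

lemma esnLaw_Iic (hN : IsPoissonPointProcess P N (intensity μ))
    (hμ : ∀ x : ℝ, 0 < x → tail μ x < ∞) (b : ℝ) (t x u : ℝ≥0) :
    esnLaw P b N t x (Set.Iic u) =
      noiseLaw P b N t (Set.Iic u) * (if Real.toNNReal (x - b * t) ≤ u then 1 else 0) := by
  rw [noiseLaw_Iic hN hμ, ← prob_esn_le hN hμ, esnLaw,
    Measure.map_apply (measurable_esn hN b x t) measurableSet_Iic]
  rfl

/-- One noise variable serves all starting points, so regularity in `x` is that of `x ↦ max((x -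
bt)₊, z)`. -/
lemma esnLaw_eq_map (hN : IsPoissonPointProcess P N (intensity μ))
    (hμ : ∀ x : ℝ, 0 < x → tail μ x < ∞) (b : ℝ) (t x : ℝ≥0) :
    esnLaw P b N t x = (noiseLaw P b N t).map (fun z => max (Real.toNNReal (x - b * t)) z) := by
  have hm : Measurable fun z => max (Real.toNNReal (x - b * t)) z := by fun_prop
  have := isProbabilityMeasure_noiseLaw hN b t
  have := isProbabilityMeasure_esnLaw hN b t x
  have := Measure.isProbabilityMeasure_map (μ := noiseLaw P b N t) hm.aemeasurable
  refine Measure.ext_of_Iic _ _ fun u => ?_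
  rw [esnLaw_Iic hN hμ, Measure.map_apply hm measurableSet_Iic]
  split_ifs with h
  · rw [mul_one]
    congr 1
    ext z
    simp only [Set.mem_Iic, Set.mem_preimage, max_le_iff, h, true_and]
  · rw [mul_zero, eq_comm]
    convert measure_empty (μ := noiseLaw P b N t)
    ext z
    simp only [Set.mem_Iic, Set.mem_preimage, max_le_iff, h, false_and, Set.mem_empty_iff_false]

lemma esnSemigroup_eq (hN : IsPoissonPointProcess P N (intensity μ))
    (hμ : ∀ x : ℝ, 0 < x → tail μ x < ∞) (b : ℝ) (t x : ℝ≥0) {f : ℝ≥0 → ℝ} (hf : Measurable f) :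
    esnSemigroup P b N t f x =
      ∫ z, f (max (Real.toNNReal (x - b * t)) z) ∂(noiseLaw P b N t) := by
  rw [esnSemigroup, esnLaw_eq_map hN hμ, integral_map (by fun_prop) hf.aestronglyMeasurable]

lemma measurable_esnLaw (hN : IsPoissonPointProcess P N (intensity μ))
    (hμ : ∀ x : ℝ, 0 < x → tail μ x < ∞) (b : ℝ) (t : ℝ≥0) : Measurable (esnLaw P b N t) := by
  have := fun x => isProbabilityMeasure_esnLaw hN b t x
  refine Measurable.measure_of_isPiSystem_of_isProbabilityMeasure
    (S := Set.range Set.Iic) ?_ isPiSystem_Iic ?_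
  · rw [BorelSpace.measurable_eq (α := ℝ≥0), borel_eq_generateFrom_Iic]
  · rintro _ ⟨u, rfl⟩
    simp only [esnLaw_Iic hN hμ]
    refine Measurable.const_mul (Measurable.ite ?_ measurable_const measurable_const) _
    exact measurableSet_le (by fun_prop) measurable_const

/-- The transition kernels of the extremal shot noise process. -/
def esnKernel (hN : IsPoissonPointProcess P N (intensity μ))
    (hμ : ∀ x : ℝ, 0 < x → tail μ x < ∞) (b : ℝ) (t : ℝ≥0) : Kernel ℝ≥0 ℝ≥0 :=
  ⟨esnLaw P b N t, measurable_esnLaw hN hμ b t⟩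

/-- Chapman–Kolmogorov for distribution functions: by the recursion the event is an intersection of
a past event and an independent event about later atoms. -/
lemma esnLaw_add_Iic (hN : IsPoissonPointProcess P N (intensity μ))
    (hμ : ∀ x : ℝ, 0 < x → tail μ x < ∞) (b : ℝ) (t s x u : ℝ≥0) :
    esnLaw P b N (t + s) x (Set.Iic u) =
      ∫⁻ y, esnLaw P b N s y (Set.Iic u) ∂(esnLaw P b N t x) := by
  have hms : Measurable fun y : ℝ≥0 => Real.toNNReal (y - b * s) := by fun_prop
  have hset : MeasurableSet {y : ℝ≥0 | Real.toNNReal (y - b * s) ≤ u} :=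
    measurableSet_le hms measurable_const
  have hpk := hN.measurable_peak (measurable_decay b (t + s))
    (measurableSet_Ioc (a := (t : ℝ)) (b := t + s)) 0
  simp only [esnLaw_Iic hN hμ b s]
  rw [lintegral_const_mul _ (Measurable.ite hset measurable_const measurable_const)]
  have h1 : ∫⁻ y : ℝ≥0, (if Real.toNNReal (y - b * s) ≤ u then 1 else 0) ∂(esnLaw P b N t x) =
      P (esn b N x t ⁻¹' {y : ℝ≥0 | Real.toNNReal (y - b * s) ≤ u}) := by
    rw [← Measure.map_apply (measurable_esn hN b x t) hset, ← lintegral_indicator_one hset]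
    rfl
  rw [h1, ← map_peak_shift hN hμ b t s, Measure.map_apply hpk measurableSet_Iic, mul_comm,
    esnLaw, Measure.map_apply (measurable_esn hN b x (t + s)) measurableSet_Iic]
  rw [← (Indep_iff _ _ P).1 (indep_esn_past_peak hN b t (t + s)) _ _
    (measurable_esn_voidSigma hN b x le_rfl hset) ⟨_, measurableSet_Iic, rfl⟩]
  refine measure_congr ?_
  filter_upwards [ae_esn_add hN hμ b x t s] with ω hω
  refine propext ?_
  change esn b N x (t + s) ω ≤ u ↔ Real.toNNReal (esn b N x t ω - b * s) ≤ u ∧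
    peak 0 (decay b (t + s)) (Set.Ioc (t : ℝ) (t + s)) (N ω) ≤ u
  rw [hω, max_le_iff]

lemma esnKernel_add (hN : IsPoissonPointProcess P N (intensity μ))
    (hμ : ∀ x : ℝ, 0 < x → tail μ x < ∞) (b : ℝ) (t s : ℝ≥0) :
    esnKernel hN hμ b (t + s) = (esnKernel hN hμ b s).comp (esnKernel hN hμ b t) := by
  ext1 x
  have : ∀ t, IsMarkovKernel (esnKernel hN hμ b t) := fun t =>
    ⟨fun x => isProbabilityMeasure_esnLaw hN b t x⟩
  refine Measure.ext_of_Iic _ _ fun u => ?_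
  rw [Kernel.comp_apply' _ _ _ measurableSet_Iic]
  exact esnLaw_add_Iic hN hμ b t s x u

lemma esnKernel_zero (hN : IsPoissonPointProcess P N (intensity μ))
    (hμ : ∀ x : ℝ, 0 < x → tail μ x < ∞) (b : ℝ) : esnKernel hN hμ b 0 = Kernel.id := by
  ext1 x
  have := isProbabilityMeasure_esnLaw hN b 0 x
  change esnLaw P b N 0 x = _
  refine Measure.ext_of_Iic _ _ fun u => ?_
  rw [Kernel.id_apply, Measure.dirac_apply' _ measurableSet_Iic, esnLaw_Iic hN hμ,
    noiseLaw_Iic hN hμ]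
  simp [expNeg_zero, Set.indicator_apply]

/-- The past is contained in the σ-algebra of void events up to time `t`, hence is independent of
the later noise; the freezing lemma then applies to the recursion. -/
lemma esn_markov (hN : IsPoissonPointProcess P N (intensity μ))
    (hμ : ∀ x : ℝ, 0 < x → tail μ x < ∞) (b : ℝ) (x t s : ℝ≥0) {f : ℝ≥0 → ℝ}
    (hf : Measurable f) {C : ℝ} (hC : ∀ y, |f y| ≤ C) :
    P[fun ω => f (esn b N x (t + s) ω) | past (esn b N x) t] =ᵐ[P]
      fun ω => esnSemigroup P b N s f (esn b N x t ω) := by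
  have hle : past (esn b N x) t ≤ voidSigma N (Set.Iic (t : ℝ) ×ˢ Set.univ) :=
    iSup_le fun r => measurable_iff_comap_le.1 (measurable_esn_voidSigma hN b x r.2)
  have hX : Measurable[past (esn b N x) t] (esn b N x t) :=
    measurable_iff_comap_le.2 (le_iSup (fun r : Set.Iic t =>
      MeasurableSpace.comap (esn b N x r) inferInstance) ⟨t, Set.mem_Iic.2 le_rfl⟩)
  have hpk := hN.measurable_peak (measurable_decay b (t + s))
    (measurableSet_Ioc (a := (t : ℝ)) (b := t + s)) 0
  have key := condExp_apply_pair_of_indep (hle.trans (hN.voidSigma_le _)) hX hpk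
    (indep_of_indep_of_le_left (indep_esn_past_peak hN b t (t + s)) hle)
    (F := fun p => f (max (Real.toNNReal (p.1 - b * s)) p.2)) (hf.comp (by fun_prop))
    (C := C) (fun p => hC _)
  refine (condExp_congr_ae ?_).trans (key.trans ?_)
  · filter_upwards [ae_esn_add hN hμ b x t s] with ω hω
    rw [hω]
  · refine Eventually.of_forall fun ω => ?_
    simp only [map_peak_shift hN hμ, esnSemigroup_eq hN hμ b s _ hf]

lemma exists_zeroAtInfty_esnSemigroup (hN : IsPoissonPointProcess P N (intensity μ))
    (hμ : ∀ x : ℝ, 0 < x → tail μ x < ∞) (b : ℝ) (t : ℝ≥0)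
    (f : ZeroAtInftyContinuousMap ℝ≥0 ℝ) :
    ∃ g : ZeroAtInftyContinuousMap ℝ≥0 ℝ, ∀ x, g x = esnSemigroup P b N t f x := by
  have := isProbabilityMeasure_noiseLaw hN b t
  have hfm : Measurable f := f.continuous.measurable
  have hb : ∀ y, ‖f y‖ ≤ ‖f.toBCF‖ := fun y => f.toBCF.norm_coe_le_norm y
  have heq : esnSemigroup P b N t f =
      fun x : ℝ≥0 => ∫ z, f (max (Real.toNNReal (x - b * t)) z) ∂(noiseLaw P b N t) :=
    funext fun x => esnSemigroup_eq hN hμ b t x hfm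
  have hmeas : ∀ x : ℝ≥0, AEStronglyMeasurable
      (fun z => f (max (Real.toNNReal (x - b * t)) z)) (noiseLaw P b N t) := fun x =>
    (hfm.comp (by fun_prop)).aestronglyMeasurable
  refine ⟨⟨⟨esnSemigroup P b N t f, ?_⟩, ?_⟩, fun x => rfl⟩
  · rw [heq]
    refine continuous_of_dominated (bound := fun _ => ‖f.toBCF‖) hmeas
      (fun x => Eventually.of_forall fun z => hb _) (integrable_const _)
      (Eventually.of_forall fun z => ?_)
    exact f.continuous.comp (by fun_prop)
  · change Tendsto (esnSemigroup P b N t f) _ _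
    rw [heq, cocompact_eq_atTop]
    have h0 : (0 : ℝ) = ∫ _z, (0 : ℝ) ∂(noiseLaw P b N t) := by simp
    rw [h0]
    refine tendsto_integral_filter_of_dominated_convergence (fun _ => ‖f.toBCF‖)
      (Eventually.of_forall hmeas) (Eventually.of_forall fun x => Eventually.of_forall fun z => hb _)
      (integrable_const _) (Eventually.of_forall fun z => ?_)
    have hf0 := f.zero_at_infty'
    rw [cocompact_eq_atTop] at hf0
    -- The argument of `f` is at least `(x - bt)₊`, which tends to infinity for each fixed noise
    -- value.
    refine hf0.comp (tendsto_atTop_mono (fun x => le_max_left _ _) ?_)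
    refine tendsto_real_toNNReal_atTop.comp ?_
    exact tendsto_atTop_add_const_right _ _ (NNReal.tendsto_coe_atTop.2 tendsto_id)

/-- Over so short a time the boundary line from level `η` stays above `η / 2`, and the intensity
above it is at most `t` times the tail there. -/
lemma noiseLaw_Ioi_le (hN : IsPoissonPointProcess P N (intensity μ))
    (hμ : ∀ x : ℝ, 0 < x → tail μ x < ∞) (b : ℝ) (t η : ℝ≥0) (h : |b| * t ≤ η / 2) :
    noiseLaw P b N t (Set.Ioi η) ≤ tail μ (η / 2) * t := by
  have := isProbabilityMeasure_noiseLaw hN b t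
  rw [← Set.compl_Iic, prob_compl_eq_one_sub measurableSet_Iic, noiseLaw_Iic hN hμ,
    ← ENNReal.ofReal_one, ← ENNReal.ofReal_sub _ (expNeg_nonneg _)]
  refine (ofReal_one_sub_expNeg_le _).trans ?_
  calc ∫⁻ r in Set.Ioc (0 : ℝ) t, strictTail μ (η + b * (t - r))
      ≤ ∫⁻ _ in Set.Ioc (0 : ℝ) t, tail μ (η / 2) := by
        refine setLIntegral_mono' measurableSet_Ioc fun r hr => ?_
        refine (strictTail_le_tail μ _).trans (tail_antitone μ ?_)
        have h1 : |b * (t - r)| ≤ |b| * t := by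
          rw [abs_mul, abs_of_nonneg (sub_nonneg.2 hr.2)]
          exact mul_le_mul_of_nonneg_left (by linarith [hr.1]) (abs_nonneg b)
        linarith [neg_abs_le (b * (t - r))]
    _ = tail μ (η / 2) * t := by
        rw [setLIntegral_const, Real.volume_Ioc, sub_zero, ENNReal.ofReal_coe_nnreal]

lemma esnSemigroup_tendstoUniformly (hN : IsPoissonPointProcess P N (intensity μ))
    (hμ : ∀ x : ℝ, 0 < x → tail μ x < ∞) (b : ℝ) (f : ZeroAtInftyContinuousMap ℝ≥0 ℝ) :
    TendstoUniformly (fun (t : ℝ≥0) (x : ℝ≥0) => esnSemigroup P b N t f x) f (𝓝 0) := by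
  have hfm : Measurable f := f.continuous.measurable
  have hb : ∀ y, ‖f y‖ ≤ ‖f.toBCF‖ := fun y => f.toBCF.norm_coe_le_norm y
  rw [Metric.tendstoUniformly_iff]
  intro ε hε
  obtain ⟨δ, hδ, hf⟩ := Metric.uniformContinuous_iff.1
    (ZeroAtInftyContinuousMap.uniformContinuous f) (ε / 2) (half_pos hε)
  -- If the noise is at most `δ / 3` and `|b| t < δ / 6`, then `max((x - bt)₊, z)` is within `δ` of
  -- `x`, uniformly in `x`. The noise exceeds `η` with probability of order `t`.
  let η : ℝ≥0 := ⟨δ / 3, by positivity⟩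
  have hη : (η : ℝ) = δ / 3 := rfl
  have ht1 : Tendsto (fun t : ℝ≥0 => |b| * (t : ℝ)) (𝓝 0) (𝓝 0) := by
    have : Continuous fun t : ℝ≥0 => |b| * (t : ℝ) := by fun_prop
    simpa using this.tendsto 0
  have ht2 : Tendsto (fun t : ℝ≥0 => ε / 2 + 2 * ‖f.toBCF‖ * ((tail μ (η / 2)).toReal * t))
      (𝓝 0) (𝓝 (ε / 2)) := by
    have : Continuous fun t : ℝ≥0 =>
      ε / 2 + 2 * ‖f.toBCF‖ * ((tail μ (η / 2)).toReal * t) := by fun_prop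
    simpa using this.tendsto 0
  filter_upwards [ht1.eventually (gt_mem_nhds (show 0 < δ / 6 by positivity)),
    ht2.eventually (gt_mem_nhds (half_lt_self hε))] with t h1 h2 x
  have := isProbabilityMeasure_noiseLaw hN b t
  have hint : Integrable (fun z => f (max (Real.toNNReal (x - b * t)) z)) (noiseLaw P b N t) :=
    Integrable.of_bound (hfm.comp (by fun_prop)).aestronglyMeasurable ‖f.toBCF‖
      (Eventually.of_forall fun z => hb _)
  have hsub : f x - esnSemigroup P b N t f x =
      ∫ z, (f x - f (max (Real.toNNReal (x - b * t)) z)) ∂(noiseLaw P b N t) := by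
    rw [integral_sub (integrable_const _) hint, esnSemigroup_eq hN hμ b t x hfm]
    simp
  rw [Real.dist_eq, hsub, ← Real.norm_eq_abs]
  refine (norm_integral_le_integral_norm _).trans_lt (lt_of_le_of_lt ?_ h2)
  have hptw : ∀ z, ‖f x - f (max (Real.toNNReal (x - b * t)) z)‖ ≤
      ε / 2 + (Set.Ioi η).indicator (fun _ => 2 * ‖f.toBCF‖) z := by
    intro z
    by_cases hz : z ∈ Set.Ioi η
    · rw [Set.indicator_of_mem hz]
      have := norm_sub_le (f x) (f (max (Real.toNNReal (x - b * t)) z))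
      linarith [hb x, hb (max (Real.toNNReal (x - b * t)) z)]
    · rw [Set.indicator_of_notMem hz, add_zero, ← dist_eq_norm]
      refine (hf ?_).le
      have hz' : (z : ℝ) ≤ δ / 3 := not_lt.1 hz
      rw [NNReal.dist_eq, NNReal.coe_max, Real.coe_toNNReal']
      have h3 : |b * t| < δ / 6 := by rwa [abs_mul, abs_of_nonneg t.coe_nonneg]
      obtain ⟨h4, h5⟩ := abs_lt.1 h3
      have h6 := x.coe_nonneg
      have h7 := z.coe_nonneg
      rw [abs_lt]
      rcases max_cases ((x : ℝ) - b * t) 0 with ⟨h8, h9⟩ | ⟨h8, h9⟩ <;>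
      rcases max_cases (max ((x : ℝ) - b * t) 0) (z : ℝ) with ⟨h10, h11⟩ | ⟨h10, h11⟩ <;>
      constructor <;> linarith
  refine (integral_mono (((integrable_const _).sub hint).norm) ((integrable_const _).add
    ((integrable_const _).indicator measurableSet_Ioi)) hptw).trans ?_
  rw [integral_add' (integrable_const _) ((integrable_const _).indicator measurableSet_Ioi),
    integral_indicator measurableSet_Ioi, setIntegral_const, integral_const, smul_eq_mul,
    smul_eq_mul, mul_comm _ (2 * ‖f.toBCF‖)]
  have hle : (noiseLaw P b N t).real (Set.Ioi η) ≤ (tail μ (η / 2)).toReal * t := by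
    have hη2 : 0 < (η : ℝ) / 2 := by rw [hη]; positivity
    have := noiseLaw_Ioi_le hN hμ b t η (by rw [hη]; linarith)
    have := ENNReal.toReal_mono (ENNReal.mul_ne_top (hμ _ hη2).ne ENNReal.coe_ne_top) this
    simpa [Measure.real] using this
  have := mul_le_mul_of_nonneg_left hle (show 0 ≤ 2 * ‖f.toBCF‖ by positivity)
  simpa [Measure.real] using this

end Markov

/-! ### The zero set. -/

lemma lintegral_tail_Ioc_lt_top {μ : Measure ℝ} (hμ : ∀ x : ℝ, 0 < x → tail μ x < ∞) {a : ℝ}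
    (ha : 0 < a) (c : ℝ) : ∫⁻ y in Set.Ioc a c, tail μ y < ∞ := by
  refine (setLIntegral_mono' measurableSet_Ioc
    (g := fun _ => tail μ a) fun y hy => tail_antitone μ hy.1.le).trans_lt ?_
  rw [setLIntegral_const, Real.volume_Ioc]
  exact ENNReal.mul_lt_top (hμ a ha) ENNReal.ofReal_lt_top

lemma lintegral_tail_Ioc_zero_lt_top {μ : Measure ℝ} (hμ : ∀ x : ℝ, 0 < x → tail μ x < ∞)
    {a c : ℝ} (ha : 0 < a) (h : ∫⁻ y in Set.Ioc 0 a, tail μ y < ∞) :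
    ∫⁻ y in Set.Ioc 0 c, tail μ y < ∞ := by
  have hsub : Set.Ioc 0 c ⊆ Set.Ioc 0 a ∪ Set.Ioc a c := fun y hy =>
    (le_or_gt y a).imp (fun h => ⟨hy.1, h⟩) fun h => ⟨h, hy.2⟩
  exact (lintegral_mono_set hsub).trans_lt ((lintegral_union_le _ _ _).trans_lt
    (ENNReal.add_lt_top.2 ⟨h, lintegral_tail_Ioc_lt_top hμ ha c⟩))

section Zero

variable {Ω : Type*} [MeasurableSpace Ω] {P : Measure Ω} [IsProbabilityMeasure P]
  {μ : Measure ℝ} [SFinite μ] {b : ℝ} {N : Ω → Measure (ℝ × ℝ)}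

lemma prob_esn_eq_zero (hN : IsPoissonPointProcess P N (intensity μ))
    (hμ : ∀ x : ℝ, 0 < x → tail μ x < ∞) (hb : 0 ≤ b) (s : ℝ≥0) :
    P {ω | esn b N 0 s ω = 0} =
      ENNReal.ofReal (expNeg (∫⁻ r in Set.Ioc (0 : ℝ) s, strictTail μ (0 + b * (s - r)))) := by
  have h := prob_esn_le hN hμ b 0 s 0
  have h0 : Real.toNNReal ((0 : ℝ≥0) - b * s) ≤ 0 := by
    rw [Real.toNNReal_le_iff_le_coe]
    simpa using mul_nonneg hb s.coe_nonneg
  rw [if_pos h0, mul_one] at h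
  simpa only [nonpos_iff_eq_zero, NNReal.coe_zero] using h

lemma prob_esn_eq_zero_pos_iff (hN : IsPoissonPointProcess P N (intensity μ))
    (hμ : ∀ x : ℝ, 0 < x → tail μ x < ∞) (hb : 0 ≤ b) (s : ℝ≥0) :
    0 < P {ω | esn b N 0 s ω = 0} ↔
      ∫⁻ r in Set.Ioc (0 : ℝ) s, strictTail μ (0 + b * (s - r)) < ∞ := by
  rw [prob_esn_eq_zero hN hμ hb, ENNReal.ofReal_pos, expNeg_pos_iff]

lemma prob_esn_eq_zero_pos_iff_of_pos (hN : IsPoissonPointProcess P N (intensity μ))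
    (hμ : ∀ x : ℝ, 0 < x → tail μ x < ∞) (hb : 0 < b) {s : ℝ≥0} (hs : 0 < s) :
    0 < P {ω | esn b N 0 s ω = 0} ↔ ∫⁻ v in Set.Ioc (0 : ℝ) 1, tail μ v < ∞ := by
  have hbs : 0 < b * s := mul_pos hb (NNReal.coe_pos.2 hs)
  rw [prob_esn_eq_zero_pos_iff hN hμ hb.le,
    lintegral_decay_strictTail_eq_tail (Or.inl hb.ne'), lintegral_tail_decay hb.ne', zero_add,
    Set.uIoc_of_le hbs.le]
  have hc : 0 < 1 / |b| := by positivity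
  constructor
  · intro h
    refine lintegral_tail_Ioc_zero_lt_top hμ hbs ?_
    rcases ENNReal.mul_lt_top_iff.1 h with h | h | h
    · exact h.2
    · exact absurd (ENNReal.ofReal_eq_zero.1 h) hc.not_ge
    · rw [h]; exact ENNReal.zero_lt_top
  · intro h
    exact ENNReal.mul_lt_top ENNReal.ofReal_lt_top
      (lintegral_tail_Ioc_zero_lt_top hμ one_pos h)

lemma prob_esn_eq_zero_pos_iff_of_eq_zero (hN : IsPoissonPointProcess P N (intensity μ))
    (hμ : ∀ x : ℝ, 0 < x → tail μ x < ∞) {s : ℝ≥0} (hs : 0 < s) :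
    0 < P {ω | esn 0 N 0 s ω = 0} ↔ μ (Set.Ioi 0) < ∞ := by
  rw [prob_esn_eq_zero_pos_iff hN hμ le_rfl]
  simp only [zero_mul, add_zero, setLIntegral_const, Real.volume_Ioc, sub_zero,
    ENNReal.ofReal_coe_nnreal]
  refine ⟨fun h => ?_, fun h => ENNReal.mul_lt_top h ENNReal.coe_lt_top⟩
  rcases ENNReal.mul_lt_top_iff.1 h with h | h | h
  · exact h.1
  · exact h.trans_lt ENNReal.zero_lt_top
  · exact absurd h (by simpa using hs.ne')

omit [IsProbabilityMeasure P] [SFinite μ] in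
lemma IsPoissonPointProcess.countable_atoms (hN : IsPoissonPointProcess P N (intensity μ))
    (ω : Ω) : (atoms (N ω)).Countable := by
  obtain ⟨I, p, hp⟩ := hN.point_measure ω
  refine (Set.countable_range fun i : I => p i).mono fun q hq => ?_
  by_contra hne
  refine hq ?_
  rw [hp, Measure.sum_apply _ (measurableSet_singleton _), ENNReal.tsum_eq_zero]
  intro i
  rw [Measure.dirac_apply' _ (measurableSet_singleton _), Set.indicator_apply_eq_zero]
  intro hi
  exact absurd ⟨i, hi⟩ hne

/-- The pairs `(t, ω)` for which an atom strictly before time `t` keeps `M(t)` positive. -/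
def coveredSet (b : ℝ) (N : Ω → Measure (ℝ × ℝ)) : Set (ℝ × Ω) :=
  ⋃ (q : ℚ) (r : ℚ), Set.Ioo (q : ℝ) r ×ˢ {ω | N ω (above (decay b r) (Set.Ico 0 (q : ℝ)) 0) = 0}ᶜ

-- The rational times make the set a countable union of measurable rectangles, hence jointly
-- measurable as Fubini requires.
omit [IsProbabilityMeasure P] [SFinite μ] in
lemma measurableSet_coveredSet (hN : IsPoissonPointProcess P N (intensity μ)) (b : ℝ) :
    MeasurableSet (coveredSet b N) :=
  MeasurableSet.iUnion fun _ => MeasurableSet.iUnion fun _ => measurableSet_Ioo.prod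
    (hN.measurableSet_void (measurableSet_above (measurable_decay _ _) measurableSet_Ico _)).compl

omit [MeasurableSpace Ω] in
lemma above_ne_zero_of_mem_coveredSet (hb : 0 ≤ b) {t : ℝ} {ω : Ω}
    (h : (t, ω) ∈ coveredSet b N) : N ω (above (decay b t) (Set.Icc 0 t) 0) ≠ 0 := by
  simp only [coveredSet, Set.mem_iUnion] at h
  obtain ⟨q, r, ⟨h1, h2⟩, h3⟩ := h
  refine fun h0 => h3 (measure_mono_null ?_ h0)
  rintro p ⟨⟨hp0, hpq⟩, hp⟩
  refine ⟨⟨hp0, (hpq.trans h1).le⟩, lt_of_le_of_lt ?_ hp⟩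
  have := mul_le_mul_of_nonneg_left (sub_le_sub_right h2.le p.1) hb
  simpa [decay] using this

-- An atom keeping `M(t)` positive and lying strictly before `t` still does so slightly after `t`.
-- Atoms at time `t` itself are excluded by hypothesis; their times form a null set.
omit [IsProbabilityMeasure P] [SFinite μ] in
lemma esn_eq_zero_of_notMem_coveredSet (hN : IsPoissonPointProcess P N (intensity μ))
    (hb : 0 ≤ b) {t : ℝ≥0} {ω : Ω} (h : ((t : ℝ), ω) ∉ coveredSet b N)
    (hat : ∀ p ∈ atoms (N ω), p.1 ≠ t) : esn b N 0 t ω = 0 := by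
  have h0 : N ω (above (decay b t) (Set.Icc 0 (t : ℝ)) 0) = 0 := by
    rw [hN.above_eq_zero_iff (measurable_decay _ _) measurableSet_Icc]
    intro p hp hpt
    by_contra hlt
    refine h ?_
    have hpt' : p.1 < t := lt_of_le_of_ne hpt.2 (hat p hp)
    obtain ⟨q, hq1, hq2⟩ := exists_rat_btwn hpt'
    simp only [decay] at hlt
    -- Until `r` the extra loss is `b(r - t) ≤ (b + 1)(r - t)`, less than the excess height;
    -- dividing by `b + 1` also covers `b = 0`.
    have hgap : 0 < (p.2 - b * (t - p.1)) / (b + 1) := div_pos (by linarith) (by linarith)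
    obtain ⟨r, hr1, hr2⟩ := exists_rat_btwn (lt_add_of_pos_right (t : ℝ) hgap)
    have hr3 : ((r : ℝ) - t) * (b + 1) < p.2 - b * (t - p.1) :=
      (lt_div_iff₀ (by linarith)).1 (by linarith)
    simp only [coveredSet, Set.mem_iUnion]
    refine ⟨q, r, ⟨hq2, hr1⟩, fun hz => hp (measure_mono_null ?_ hz)⟩
    rw [Set.singleton_subset_iff]
    refine ⟨⟨hpt.1, hq1⟩, ?_⟩
    simp only [decay]
    nlinarith
  have h1 := (hN.peak_le_iff_of_bdd (measurable_decay b t) measurableSet_Icc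
    (Real.toNNReal ((0 : ℝ≥0) - b * t)) ω 0 ⟨0, by simpa using h0⟩).2
    ⟨by rw [Real.toNNReal_le_iff_le_coe]; simpa using mul_nonneg hb t.coe_nonneg,
      by simpa using h0⟩
  rw [← esn_eq_peak] at h1
  exact le_antisymm h1 zero_le

/-- Reversal of time in the integral of `g (b (s - r))`. -/
lemma lintegral_reverse (f : ℝ → ℝ≥0∞) (s : ℝ) :
    ∫⁻ r in Set.Ioc 0 s, f (s - r) = ∫⁻ v in Set.Ioc 0 s, f v := by
  have h := lintegral_comp_affine (neg_ne_zero.2 one_ne_zero) s f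
    (measurableSet_Icc (a := (0 : ℝ)) (b := s)) (J := Set.Icc 0 s) (by
      have : (fun r : ℝ => s + -1 * r) = fun r => s - r := by ext; ring
      rw [this]; simp)
  rw [setLIntegral_congr Ioc_ae_eq_Icc, setLIntegral_congr Ioc_ae_eq_Icc]
  simpa [sub_eq_add_neg] using h

/-- If the zeros are null, the covered times fill `(0, ε]` up to a null set, so the covered length
`G` is at least `ε`. As `E G ≤ ε q(ε)`, Markov's inequality gives this probability at most `q(ε)`,
which tends to 0. -/
lemma ae_volume_zeros_pos (hN : IsPoissonPointProcess P N (intensity μ))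
    (hμ : ∀ x : ℝ, 0 < x → tail μ x < ∞) (hb : 0 ≤ b)
    (hpos : ∀ s : ℝ≥0, 0 < s → 0 < P {ω | esn b N 0 s ω = 0}) :
    ∀ᵐ ω ∂P, 0 < volume {t : ℝ | 0 < t ∧ esn b N 0 t.toNNReal ω = 0} := by
  set q : ℝ → ℝ≥0∞ := fun s => ∫⁻ v in Set.Ioc 0 s, strictTail μ (b * v) with hq
  have hν : ∀ t : ℝ, intensity μ (above (decay b t) (Set.Icc 0 t) 0) = q t := by
    intro t
    rw [intensity_above (measurable_decay _ _) measurableSet_Icc Set.Icc_subset_Ici_self,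
      setLIntegral_congr Ioc_ae_eq_Icc.symm, hq]
    simp only [zero_add, decay]
    exact lintegral_reverse (fun v => strictTail μ (b * v)) t
  have hq1 : q 1 < ∞ := by
    have := (prob_esn_eq_zero_pos_iff hN hμ hb 1).1 (hpos 1 one_pos)
    simp only [zero_add, NNReal.coe_one] at this
    rwa [lintegral_reverse (fun v => strictTail μ (b * v)) 1] at this
  -- Absolute continuity of the integral, from the finiteness of `q 1`.
  have hqt : Tendsto q (𝓝[>] 0) (𝓝 0) := by
    have h := tendsto_setLIntegral_zero (μ := volume.restrict (Set.Ioc (0 : ℝ) 1)) hq1.ne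
      (l := 𝓝[>] (0 : ℝ)) (s := fun s => Set.Ioc 0 s) ?_
    · refine h.congr' ?_
      filter_upwards [Ioc_mem_nhdsGT (zero_lt_one (α := ℝ))] with s hs
      rw [Measure.restrict_restrict measurableSet_Ioc, Set.inter_eq_self_of_subset_left
        (Set.Ioc_subset_Ioc_right hs.2)]
    · have h0 : Tendsto (fun s : ℝ => ENNReal.ofReal s) (𝓝[>] 0) (𝓝 0) := by
        have := (ENNReal.continuous_ofReal.tendsto 0).mono_left
          (nhdsWithin_le_nhds (s := Set.Ioi (0 : ℝ)))
        simpa using this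
      refine tendsto_of_tendsto_of_tendsto_of_le_of_le tendsto_const_nhds h0
        (fun _ => zero_le) fun s => ?_
      refine (Measure.restrict_apply_le _ _).trans ?_
      simp
  rw [ae_iff]
  refine le_antisymm (le_of_forall_gt fun δ hδ => ?_) zero_le
  obtain ⟨ε, hεδ, hε⟩ := ((hqt.eventually (gt_mem_nhds hδ)).and self_mem_nhdsWithin).exists
  replace hε : 0 < ε := hε
  have hε' : ENNReal.ofReal ε ≠ 0 := by simpa using hε
  refine lt_of_le_of_lt ?_ hεδ
  let D := coveredSet b N
  have hD : MeasurableSet D := measurableSet_coveredSet hN b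
  let G : Ω → ℝ≥0∞ := fun ω => volume.restrict (Set.Ioc 0 ε) ((fun t => (t, ω)) ⁻¹' D)
  have hG : ∫⁻ ω, G ω ∂P ≤ ENNReal.ofReal ε * q ε := by
    rw [← Measure.prod_apply_symm hD, Measure.prod_apply hD]
    refine (setLIntegral_mono' measurableSet_Ioc (g := fun _ => q ε) fun t ht => ?_).trans ?_
    · refine (measure_mono (t := {ω | N ω (above (decay b t) (Set.Icc 0 t) 0) ≠ 0})
        fun ω hω => above_ne_zero_of_mem_coveredSet hb hω).trans ((hN.prob_ne_zero_le (measurableSet_above (measurable_decay _ _)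
          measurableSet_Icc _)).trans ?_)
      rw [hν]
      exact lintegral_mono_set (Set.Ioc_subset_Ioc_right ht.2)
    · rw [setLIntegral_const, Real.volume_Ioc, sub_zero, mul_comm]
  have hmarkov : P {ω | ENNReal.ofReal ε ≤ G ω} ≤ q ε := by
    have h := (mul_meas_ge_le_lintegral (measurable_measure_prodMk_right hD)
      (ENNReal.ofReal ε)).trans hG
    exact (ENNReal.mul_le_mul_iff_right hε' ENNReal.ofReal_ne_top).1 h
  refine (measure_mono fun ω hω => ?_).trans hmarkov
  have hz : volume {t : ℝ | 0 < t ∧ esn b N 0 t.toNNReal ω = 0} = 0 := by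
    simpa using hω
  have hc : volume (Prod.fst '' atoms (N ω)) = 0 :=
    ((hN.countable_atoms ω).image _).measure_zero volume
  have hcover : Set.Ioc 0 ε ⊆ ((fun t => (t, ω)) ⁻¹' D ∩ Set.Ioc 0 ε) ∪
      ({t : ℝ | 0 < t ∧ esn b N 0 t.toNNReal ω = 0} ∪ Prod.fst '' atoms (N ω)) := by
    intro t ht
    by_cases h1 : (t, ω) ∈ D
    · exact Or.inl ⟨h1, ht⟩
    by_cases h2 : t ∈ Prod.fst '' atoms (N ω)
    · exact Or.inr (Or.inr h2)
    refine Or.inr (Or.inl ⟨ht.1, ?_⟩)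
    have htc : ((t.toNNReal : ℝ≥0) : ℝ) = t := Real.coe_toNNReal _ ht.1.le
    refine esn_eq_zero_of_notMem_coveredSet hN hb (by rwa [htc]) fun p hp hpt => h2 ⟨p, hp, ?_⟩
    rw [hpt, htc]
  have hvol := (measure_mono (μ := volume) hcover).trans ((measure_union_le _ _).trans
    (add_le_add le_rfl (measure_union_le _ _)))
  rw [hz, hc, add_zero, add_zero, Real.volume_Ioc, sub_zero] at hvol
  change ENNReal.ofReal ε ≤ G ω
  exact hvol.trans_eq (Measure.restrict_apply' measurableSet_Ioc).symm

end Zero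

/-! ### Long-term behaviour and the stationary law. -/

/-- The coupling inequality: on `X = Y` the two preimages of any set coincide. -/
lemma tvDist_map_le {Ω E : Type*} [MeasurableSpace Ω] [MeasurableSpace E] {P : Measure Ω}
    [IsProbabilityMeasure P] {X Y : Ω → E} (hX : Measurable X) (hY : Measurable Y) :
    tvDist (P.map X) (P.map Y) ≤ P.real {ω | X ω ≠ Y ω} := by
  have : Nonempty {A : Set E // MeasurableSet A} := ⟨⟨∅, MeasurableSet.empty⟩⟩
  have key : ∀ {X Y : Ω → E} (A : Set E), P.real (X ⁻¹' A) ≤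
      P.real (Y ⁻¹' A) + P.real {ω | X ω ≠ Y ω} := by
    intro X Y A
    refine (measureReal_mono (s₂ := Y ⁻¹' A ∪ {ω | X ω ≠ Y ω}) fun ω hω => ?_).trans
      (measureReal_union_le _ _)
    by_cases h : X ω = Y ω
    · exact Or.inl (by rwa [Set.mem_preimage, ← h])
    · exact Or.inr h
  refine ciSup_le fun A => ?_
  rw [map_measureReal_apply hX A.2, map_measureReal_apply hY A.2, abs_le]
  have h1 := key (X := X) (Y := Y) A.1
  have h2 := key (X := Y) (Y := X) A.1
  have h3 : {ω | Y ω ≠ X ω} = {ω | X ω ≠ Y ω} := by ext; exact ne_comm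
  rw [h3] at h2
  constructor <;> linarith

lemma tvDist_nonneg {E : Type*} [MeasurableSpace E] (p q : Measure E) : 0 ≤ tvDist p q :=
  Real.iSup_nonneg fun _ => abs_nonneg _

section Ergodic

variable {Ω : Type*} [MeasurableSpace Ω] {P : Measure Ω} [IsProbabilityMeasure P]
  {μ : Measure ℝ} {b : ℝ} {N : Ω → Measure (ℝ × ℝ)}

lemma tendsto_lintegral_tail_Ioc (hb : 0 < b) (K : ℝ) :
    Tendsto (fun s : ℝ≥0 => ∫⁻ y in Set.Ioc K (K + b * s), tail μ y) atTop
      (𝓝 (∫⁻ y in Set.Ioi K, tail μ y)) := by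
  have hU : ⋃ s : ℝ≥0, Set.Ioc K (K + b * s) = Set.Ioi K := by
    refine Set.Subset.antisymm (Set.iUnion_subset fun s => Set.Ioc_subset_Ioi_self) fun y hy => ?_
    have hy' : 0 ≤ (y - K) / b := div_nonneg (sub_nonneg.2 (le_of_lt hy)) hb.le
    refine Set.mem_iUnion.2 ⟨NNReal.mk ((y - K) / b) hy', hy, ?_⟩
    rw [NNReal.coe_mk, mul_div_cancel₀ _ hb.ne']
    linarith
  have h := tendsto_measure_iUnion_atTop (μ := volume.withDensity (tail μ))
    (s := fun s : ℝ≥0 => Set.Ioc K (K + b * s)) fun s t hst => Set.Ioc_subset_Ioc_right (by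
      have := mul_le_mul_of_nonneg_left (NNReal.coe_le_coe.2 hst) hb.le
      linarith)
  rw [hU, withDensity_apply _ measurableSet_Ioi] at h
  simpa only [Function.comp_def, withDensity_apply _ measurableSet_Ioc] using h

lemma tendsto_lintegral_tail_Ioi (hb : 0 < b) (hfin : ∫⁻ v in Set.Ioi (1 : ℝ), tail μ v < ∞) :
    Tendsto (fun t : ℝ≥0 => ∫⁻ y in Set.Ioi (b * t), tail μ y) atTop (𝓝 0) := by
  have hI : ⋂ t : ℝ≥0, Set.Ioi (b * t) = ∅ := by
    refine Set.eq_empty_of_forall_notMem fun y hy => ?_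
    have h := Set.mem_iInter.1 hy (Real.toNNReal (y / b))
    rw [Set.mem_Ioi, Real.coe_toNNReal'] at h
    have := mul_le_mul_of_nonneg_left (le_max_left (y / b) 0) hb.le
    rw [mul_div_cancel₀ _ hb.ne'] at this
    linarith
  have h := tendsto_measure_iInter_atTop (μ := volume.withDensity (tail μ))
    (s := fun t : ℝ≥0 => Set.Ioi (b * t)) (fun t => measurableSet_Ioi.nullMeasurableSet)
    (fun s t hst => Set.Ioi_subset_Ioi
      (mul_le_mul_of_nonneg_left (NNReal.coe_le_coe.2 hst) hb.le))
    ⟨NNReal.mk (1 / b) (by positivity), by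
      rw [withDensity_apply _ measurableSet_Ioi, NNReal.coe_mk, mul_one_div_cancel hb.ne']
      exact hfin.ne⟩
  rw [hI, measure_empty] at h
  simpa only [Function.comp_def, withDensity_apply _ measurableSet_Ioi] using h

lemma lintegral_tail_Ioi_lt_top (hμ : ∀ x : ℝ, 0 < x → tail μ x < ∞) {a c : ℝ} (hc : 0 < c)
    (h : ∫⁻ v in Set.Ioi a, tail μ v < ∞) : ∫⁻ v in Set.Ioi c, tail μ v < ∞ := by
  have hsub : Set.Ioi c ⊆ Set.Ioi a ∪ Set.Ioc c a := fun y hy =>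
    (lt_or_ge a y).imp id fun h => ⟨hy, h⟩
  exact (lintegral_mono_set hsub).trans_lt ((lintegral_union_le _ _ _).trans_lt
    (ENNReal.add_lt_top.2 ⟨h, lintegral_tail_Ioc_lt_top hμ hc a⟩))

variable [SFinite μ]

lemma noiseLaw_Iic_of_pos (hN : IsPoissonPointProcess P N (intensity μ))
    (hμ : ∀ x : ℝ, 0 < x → tail μ x < ∞) (hb : 0 < b) (t u : ℝ≥0) :
    noiseLaw P b N t (Set.Iic u) = ENNReal.ofReal (expNeg
      (ENNReal.ofReal (1 / b) * ∫⁻ y in Set.Ioc (u : ℝ) (u + b * t), tail μ y)) := by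
  have hbt : (u : ℝ) ≤ u + b * t := by
    have := mul_nonneg hb.le t.coe_nonneg
    linarith
  rw [noiseLaw_Iic hN hμ, lintegral_decay_strictTail_eq_tail (Or.inl hb.ne'),
    lintegral_tail_decay hb.ne', Set.uIoc_of_le hbt, abs_of_pos hb]

/-- The starting point enters as a factor at most 1, and the exponent of the noise increases to
infinity. -/
lemma tendsto_prob_esn_le_of_tail_infinite (hN : IsPoissonPointProcess P N (intensity μ))
    (hμ : ∀ x : ℝ, 0 < x → tail μ x < ∞) (hb : 0 < b)
    (hinf : ∫⁻ v in Set.Ioi (1 : ℝ), tail μ v = ∞) (x K : ℝ≥0) :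
    Tendsto (fun s : ℝ≥0 => P {ω | esn b N x s ω ≤ K}) atTop (𝓝 0) := by
  have hK : ∫⁻ v in Set.Ioi (K : ℝ), tail μ v = ∞ := by
    by_contra h
    exact (lintegral_tail_Ioi_lt_top hμ one_pos (lt_top_iff_ne_top.2 h)).ne hinf
  have h1 : Tendsto (fun s : ℝ≥0 => ENNReal.ofReal (1 / b) *
      ∫⁻ y in Set.Ioc (K : ℝ) (K + b * s), tail μ y) atTop (𝓝 ∞) := by
    have := ENNReal.Tendsto.const_mul (a := ENNReal.ofReal (1 / b))
      (tendsto_lintegral_tail_Ioc (μ := μ) hb K) (Or.inr ENNReal.ofReal_ne_top)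
    rwa [hK, ENNReal.mul_top (by simpa using hb)] at this
  have h2 := ENNReal.tendsto_ofReal (tendsto_expNeg_top.comp h1)
  rw [ENNReal.ofReal_zero] at h2
  refine tendsto_of_tendsto_of_tendsto_of_le_of_le tendsto_const_nhds h2 (fun _ => zero_le)
    fun s => ?_
  have h3 : P {ω | esn b N x s ω ≤ K} = esnLaw P b N s x (Set.Iic K) :=
    (Measure.map_apply (measurable_esn hN b x s) measurableSet_Iic).symm
  simp only [h3]
  rw [esnLaw_Iic hN hμ, noiseLaw_Iic_of_pos hN hμ hb]
  refine (mul_le_of_le_one_right zero_le ?_).trans_eq rfl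
  split_ifs <;> simp

omit [IsProbabilityMeasure P] [SFinite μ] in
lemma measurable_peak_linear (hN : IsPoissonPointProcess P N (intensity μ)) (b : ℝ) {I : Set ℝ}
    (hI : MeasurableSet I) : Measurable fun ω => peak 0 (fun r => b * r) I (N ω) :=
  hN.measurable_peak (by fun_prop) hI 0

omit [IsProbabilityMeasure P] in
lemma intensity_above_linear (hb : 0 < b) (u a : ℝ) (ha : 0 ≤ a) :
    intensity μ (above (fun r => b * r) (Set.Ioi a) u) =
      ENNReal.ofReal (1 / b) * ∫⁻ v in Set.Ioi (u + b * a), tail μ v := by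
  rw [intensity_above (by fun_prop) measurableSet_Ioi
    (fun r hr => ha.trans (le_of_lt hr))]
  rw [lintegral_strictTail_eq_tail (ae_restrict_of_ae (ae_apply_not_atom (b := -b)
    (neg_ne_zero.2 hb.ne') (fun _ : Unit => u) fun r => ⟨(), by ring⟩)),
    lintegral_comp_affine hb.ne' u (tail μ) measurableSet_Ioi (J := Set.Ioi (u + b * a)),
    abs_of_pos hb]
  have : (fun r : ℝ => u + b * r) = (fun y => u + y) ∘ (fun r => b * r) := rfl
  rw [this, Set.image_comp, Set.image_mul_left_Ioi hb, Set.image_const_add_Ioi]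

omit [IsProbabilityMeasure P] in
lemma exists_intensity_above_linear_ne_top (hb : 0 < b)
    (hfin : ∫⁻ v in Set.Ioi (1 : ℝ), tail μ v < ∞) :
    ∃ k : ℕ, intensity μ (above (fun r => b * r) (Set.Ioi 0) k) ≠ ∞ := by
  refine ⟨1, ?_⟩
  rw [intensity_above_linear hb _ _ le_rfl]
  simpa using ENNReal.mul_ne_top ENNReal.ofReal_ne_top hfin.ne

/-- The stationary law: the law of the supremum of `(ξ - b r)₊` over all atoms `(r, ξ)`, the time
axis being reversed. -/
def stationaryLaw (P : Measure Ω) (b : ℝ) (N : Ω → Measure (ℝ × ℝ)) : Measure ℝ≥0 :=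
  P.map fun ω => peak 0 (fun r => b * r) (Set.Ioi 0) (N ω)

lemma stationaryLaw_Iic (hN : IsPoissonPointProcess P N (intensity μ)) (hb : 0 < b)
    (hfin : ∫⁻ v in Set.Ioi (1 : ℝ), tail μ v < ∞) (u : ℝ≥0) :
    stationaryLaw P b N (Set.Iic u) =
      ENNReal.ofReal (expNeg (ENNReal.ofReal (1 / b) * ∫⁻ v in Set.Ioi (u : ℝ), tail μ v)) := by
  have h := hN.prob_peak_le (by fun_prop) measurableSet_Ioi
    (exists_intensity_above_linear_ne_top hb hfin) 0 u
  rw [if_pos zero_le, mul_one, intensity_above_linear hb _ _ le_rfl, mul_zero, add_zero] at h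
  rw [stationaryLaw, Measure.map_apply (measurable_peak_linear hN b measurableSet_Ioi)
    measurableSet_Iic]
  exact h

/-- The noise contributes the integral over `(u, u + bt]`; the stationary law at level `u + bt`
contributes the rest of `(u, ∞)`. -/
lemma stationaryLaw_bind (hN : IsPoissonPointProcess P N (intensity μ))
    (hμ : ∀ x : ℝ, 0 < x → tail μ x < ∞) (hb : 0 < b)
    (hfin : ∫⁻ v in Set.Ioi (1 : ℝ), tail μ v < ∞) (t : ℝ≥0) :
    (stationaryLaw P b N).bind (esnLaw P b N t) = stationaryLaw P b N := by
  have : IsProbabilityMeasure (stationaryLaw P b N) :=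
    Measure.isProbabilityMeasure_map (measurable_peak_linear hN b measurableSet_Ioi).aemeasurable
  have hm := measurable_esnLaw hN hμ b t
  symm
  refine Measure.ext_of_Iic _ _ fun u => ?_
  rw [Measure.bind_apply measurableSet_Iic hm.aemeasurable]
  have hbt := mul_nonneg hb.le t.coe_nonneg
  obtain ⟨v, hv⟩ : ∃ v : ℝ≥0, (v : ℝ) = u + b * t := ⟨⟨_, add_nonneg u.coe_nonneg hbt⟩, rfl⟩
  have hind : ∀ y : ℝ≥0, esnLaw P b N t y (Set.Iic u) =
      noiseLaw P b N t (Set.Iic u) * (Set.Iic v).indicator 1 y := by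
    intro y
    have : Real.toNNReal (y - b * t) ≤ u ↔ y ≤ v := by
      rw [Real.toNNReal_le_iff_le_coe, ← NNReal.coe_le_coe, hv, sub_le_iff_le_add]
    rw [esnLaw_Iic hN hμ]
    simp only [this, Set.indicator_apply, Set.mem_Iic, Pi.one_apply]
  simp only [hind]
  rw [lintegral_const_mul _ (measurable_one.indicator measurableSet_Iic),
    lintegral_indicator_one measurableSet_Iic, noiseLaw_Iic_of_pos hN hμ hb,
    stationaryLaw_Iic hN hb hfin, stationaryLaw_Iic hN hb hfin, hv,
    ← ENNReal.ofReal_mul (expNeg_nonneg _), ← expNeg_add, ← mul_add,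
    ← lintegral_union measurableSet_Ioi (Set.disjoint_left.2 fun y hy hy' => hy.2.not_gt hy'),
    Set.Ioc_union_Ioi_eq_Ioi (by linarith)]

/-- A mass at 0 forces the tail to vanish almost everywhere, hence everywhere on `(0, ∞)` by
monotonicity, so `μ = 0`. A mass at `a > 0` is excluded because the distribution function is
positive at `a / 2`. -/
lemma stationaryLaw_ne_dirac (hN : IsPoissonPointProcess P N (intensity μ))
    (h0 : μ (Set.Iic 0) = 0) (hμ : ∀ x : ℝ, 0 < x → tail μ x < ∞) (hb : 0 < b)
    (hfin : ∫⁻ v in Set.Ioi (1 : ℝ), tail μ v < ∞) (hne : μ ≠ 0) (a : ℝ≥0) :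
    stationaryLaw P b N ≠ Measure.dirac a := by
  intro h
  have hcdf := stationaryLaw_Iic hN hb hfin
  rw [h] at hcdf
  have hb' : ENNReal.ofReal (1 / b) ≠ 0 := by simpa using hb
  rcases eq_or_lt_of_le (zero_le : 0 ≤ a) with ha | ha
  · have h1 := hcdf 0
    rw [← ha, Measure.dirac_apply' _ measurableSet_Iic, Set.indicator_of_mem
      (Set.mem_Iic.2 le_rfl), Pi.one_apply, eq_comm, ENNReal.ofReal_eq_one, expNeg_eq_one_iff,
      mul_eq_zero, or_iff_right hb', NNReal.coe_zero, lintegral_eq_zero_iff (measurable_tail μ)]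
      at h1
    have htail : ∀ c : ℝ, 0 < c → tail μ c = 0 := by
      intro c hc
      by_contra hc0
      have h2 : ∀ᵐ y ∂(volume.restrict (Set.Ioc 0 c)), False := by
        filter_upwards [ae_restrict_of_ae_restrict_of_subset Set.Ioc_subset_Ioi_self h1,
          ae_restrict_mem measurableSet_Ioc] with y hy hyc
        refine hc0 (le_antisymm ((tail_antitone μ hyc.2).trans hy.le) zero_le)
      have h3 : volume (Set.Ioc 0 c) = 0 :=
        Measure.restrict_eq_zero.1 (ae_eq_bot.1 (eventually_false_iff_eq_bot.1 h2))
      rw [Real.volume_Ioc, sub_zero, ENNReal.ofReal_eq_zero] at h3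
      linarith
    refine hne (Measure.measure_univ_eq_zero.1 ?_)
    have hU : (Set.univ : Set ℝ) ⊆ Set.Iic 0 ∪ ⋃ n : ℕ, Set.Ici (1 / ((n : ℝ) + 1)) := by
      intro y _
      rcases le_or_gt y 0 with hy | hy
      · exact Or.inl hy
      · obtain ⟨n, hn⟩ := exists_nat_one_div_lt hy
        exact Or.inr (Set.mem_iUnion.2 ⟨n, hn.le⟩)
    refine measure_mono_null hU (measure_union_null h0 (measure_iUnion_null fun n => ?_))
    exact htail _ (by positivity)
  · have h1 := hcdf (a / 2)
    rw [Measure.dirac_apply' _ measurableSet_Iic, Set.indicator_of_notMem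
      (by simpa using NNReal.half_lt_self ha.ne'), eq_comm, ENNReal.ofReal_eq_zero] at h1
    refine h1.not_gt (expNeg_pos_iff.2 (ENNReal.mul_lt_top ENNReal.ofReal_lt_top
      (lintegral_tail_Ioi_lt_top hμ ?_ hfin)))
    exact NNReal.coe_pos.2 (half_pos ha)

/-- Time reversal `r ↦ t - r`; once `x ≤ bt` the starting point is forgotten. Different `t` are
thereby coupled monotonically on one space. -/
lemma esnLaw_eq_map_peak_linear (hN : IsPoissonPointProcess P N (intensity μ))
    (hμ : ∀ x : ℝ, 0 < x → tail μ x < ∞) (hb : 0 < b) {x t : ℝ≥0} (hxt : (x : ℝ) ≤ b * t) :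
    esnLaw P b N t x = P.map fun ω => peak 0 (fun r => b * r) (Set.Ioc 0 (t : ℝ)) (N ω) := by
  have hm := measurable_peak_linear hN b (measurableSet_Ioc (a := (0 : ℝ)) (b := t))
  have := isProbabilityMeasure_esnLaw hN b t x
  have := Measure.isProbabilityMeasure_map (μ := P) hm.aemeasurable
  refine Measure.ext_of_Iic _ _ fun u => ?_
  have hx : Real.toNNReal (x - b * t) ≤ u := by
    rw [Real.toNNReal_of_nonpos (by linarith)]
    exact zero_le
  have h := hN.prob_peak_le (g := fun r => b * r) (by fun_prop) measurableSet_Ioc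
    (exists_intensity_above_ne_top hμ (by fun_prop) measurableSet_Ioc (C := 0) (T := t)
      Set.Ioc_subset_Icc_self (fun r hr => mul_nonneg hb.le hr.1.le)) 0 u
  rw [if_pos zero_le, mul_one, intensity_above (by fun_prop) measurableSet_Ioc
    (fun r hr => hr.1.le)] at h
  rw [esnLaw_Iic hN hμ, if_pos hx, mul_one, noiseLaw_Iic hN hμ,
    Measure.map_apply hm measurableSet_Iic]
  refine Eq.trans ?_ h.symm
  congr 2
  exact lintegral_reverse (fun v => strictTail μ (u + b * v)) t

lemma tvDist_esnLaw_stationaryLaw_le (hN : IsPoissonPointProcess P N (intensity μ))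
    (hμ : ∀ x : ℝ, 0 < x → tail μ x < ∞) (hb : 0 < b)
    (hfin : ∫⁻ v in Set.Ioi (1 : ℝ), tail μ v < ∞) {x t : ℝ≥0} (hxt : (x : ℝ) / b < t) :
    ENNReal.ofReal (tvDist (esnLaw P b N t x) (stationaryLaw P b N)) ≤
      ENNReal.ofReal (1 / b) * ∫⁻ v in Set.Ioi (b * (t : ℝ)), tail μ v := by
  have hxt' : (x : ℝ) ≤ b * t := by
    rw [div_lt_iff₀ hb] at hxt
    linarith
  rw [esnLaw_eq_map_peak_linear hN hμ hb hxt', stationaryLaw]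
  refine (ENNReal.ofReal_le_ofReal (tvDist_map_le
    (measurable_peak_linear hN b measurableSet_Ioc)
    (measurable_peak_linear hN b measurableSet_Ioi))).trans ?_
  rw [ofReal_measureReal]
  have hae : ∀ᵐ ω ∂P, peak 0 (fun r => b * r) (Set.Ioc 0 (t : ℝ)) (N ω) ≠
      peak 0 (fun r => b * r) (Set.Ioi 0) (N ω) →
      N ω (above (fun r => b * r) (Set.Ioi (t : ℝ)) 0) ≠ 0 := by
    filter_upwards [hN.ae_peak_le_iff (g := fun r => b * r) (by fun_prop) measurableSet_Ioc
      (exists_intensity_above_ne_top hμ (by fun_prop) measurableSet_Ioc (C := 0) (T := t)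
        Set.Ioc_subset_Icc_self (fun r hr => mul_nonneg hb.le hr.1.le)) 0,
      hN.ae_peak_le_iff (by fun_prop) measurableSet_Ioi
        (exists_intensity_above_linear_ne_top hb hfin) 0] with ω h1 h2 hne h3
    -- Without an atom after `t` above `br`, the late atoms impose no constraint at any level `u ≥
    -- 0`, so both suprema have the same upper bounds.
    refine hne (eq_of_forall_ge_iff fun u => ?_)
    rw [h1, h2]
    refine and_congr_right fun _ => ⟨fun h => ?_, fun h => ?_⟩
    · refine measure_mono_null (t := _ ∪ _) (fun p hp => ?_) (measure_union_null h h3)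
      rcases le_or_gt p.1 t with hpt | hpt
      · exact Or.inl ⟨⟨hp.1, hpt⟩, hp.2⟩
      · exact Or.inr (above_anti _ _ u.coe_nonneg ⟨hpt, hp.2⟩)
    · exact measure_mono_null (above_mono _ Set.Ioc_subset_Ioi_self _) h
  refine (measure_mono_ae hae).trans ((hN.prob_ne_zero_le
    (measurableSet_above (by fun_prop) measurableSet_Ioi 0)).trans ?_)
  rw [intensity_above_linear hb _ _ t.coe_nonneg, zero_add]

lemma tendsto_tvDist_esnLaw (hN : IsPoissonPointProcess P N (intensity μ))
    (hμ : ∀ x : ℝ, 0 < x → tail μ x < ∞) (hb : 0 < b)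
    (hfin : ∫⁻ v in Set.Ioi (1 : ℝ), tail μ v < ∞) (x : ℝ≥0) :
    Tendsto (fun t : ℝ≥0 => tvDist (esnLaw P b N t x) (stationaryLaw P b N)) atTop (𝓝 0) := by
  have h1 := ENNReal.Tendsto.const_mul (a := ENNReal.ofReal (1 / b))
    (tendsto_lintegral_tail_Ioi hb hfin) (Or.inr ENNReal.ofReal_ne_top)
  rw [mul_zero] at h1
  have h2 : Tendsto (fun t : ℝ≥0 => ENNReal.ofReal
      (tvDist (esnLaw P b N t x) (stationaryLaw P b N))) atTop (𝓝 0) := by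
    refine tendsto_of_tendsto_of_tendsto_of_le_of_le' tendsto_const_nhds h1
      (Eventually.of_forall fun _ => zero_le) ?_
    filter_upwards [(NNReal.tendsto_coe_atTop.2 tendsto_id).eventually
      (eventually_gt_atTop ((x : ℝ) / b))] with t ht
    exact tvDist_esnLaw_stationaryLaw_le hN hμ hb hfin ht
  have h3 := (ENNReal.tendsto_toReal ENNReal.zero_ne_top).comp h2
  simpa [Function.comp_def, ENNReal.toReal_ofReal, tvDist_nonneg] using h3

end Ergodic

end ESN

end

/-! ### The theorem. -/

theorem theorem2p1 {Ω : Type*} [MeasurableSpace Ω] (P : Measure Ω) [IsProbabilityMeasure P]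
    (b : ℝ) (μ : Measure ℝ) (hμ_supp : μ (Set.Iic 0) = 0)
    (hμ_tail : ∀ x : ℝ, 0 < x → ESN.tail μ x < ∞)
    (N : Ω → Measure (ℝ × ℝ)) (hN : ESN.IsPoissonPointProcess P N (ESN.intensity μ)) :
    -- each `M^x(t)` is a random variable
    (∀ x t : ℝ≥0, Measurable (ESN.esn b N x t)) ∧
    -- (1) finite-dimensional laws, with `μ((x, ∞))` for all `b`,
    -- with `μ([x, ∞))` if `b ≠ 0` or `μ` is diffuse
    (∀ (n : ℕ) (s : Fin (n + 1) → ℝ≥0) (u : Fin n → ℝ≥0), s 0 = 0 → StrictMono s →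
      (P.real {ω | ∀ i : Fin n, ESN.esn b N 0 (s i.succ) ω ≤ u i} =
        ESN.expNeg (ESN.fddExponent (ESN.strictTail μ) b s u) *
          ∏ i : Fin n, (if max (-b * (s i.succ : ℝ)) 0 ≤ (u i : ℝ) then (1 : ℝ) else 0)) ∧
      ((b ≠ 0 ∨ ∀ x, μ {x} = 0) →
        P.real {ω | ∀ i : Fin n, ESN.esn b N 0 (s i.succ) ω ≤ u i} =
          ESN.expNeg (ESN.fddExponent (ESN.tail μ) b s u) *
            ∏ i : Fin n, (if max (-b * (s i.succ : ℝ)) 0 ≤ (u i : ℝ) then (1 : ℝ) else 0))) ∧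
    -- (1) one-dimensional laws
    (∀ (s : ℝ≥0) (u : ℝ),
      (P.real {ω | (ESN.esn b N 0 s ω : ℝ) ≤ u} =
        ESN.expNeg (∫⁻ t in Set.Ioc (0 : ℝ) (s : ℝ), ESN.strictTail μ (u + b * ((s : ℝ) - t))) *
          (if max (-b * (s : ℝ)) 0 ≤ u then (1 : ℝ) else 0)) ∧
      ((b ≠ 0 ∨ ∀ x, μ {x} = 0) →
        P.real {ω | (ESN.esn b N 0 s ω : ℝ) ≤ u} =
          ESN.expNeg (∫⁻ t in Set.Ioc (0 : ℝ) (s : ℝ), ESN.tail μ (u + b * ((s : ℝ) - t))) *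
            (if max (-b * (s : ℝ)) 0 ≤ u then (1 : ℝ) else 0)) ∧
      -- `(1 / b) ∫_u^{u + b s}` is `(1 / |b|)` times the integral over the unoriented interval
      (b ≠ 0 →
        P.real {ω | (ESN.esn b N 0 s ω : ℝ) ≤ u} =
          ESN.expNeg (ENNReal.ofReal (1 / |b|) *
              ∫⁻ y in Set.uIoc u (u + b * (s : ℝ)), ESN.tail μ y) *
            (if max (-b * (s : ℝ)) 0 ≤ u then (1 : ℝ) else 0))) ∧
    -- (2) one-dimensional laws started from `x`
    (∀ (x t : ℝ≥0) (u : ℝ),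
      P.real {ω | (ESN.esn b N x t ω : ℝ) ≤ u} =
        P.real {ω | (ESN.esn b N 0 t ω : ℝ) ≤ u} *
          (if max ((x : ℝ) - b * (t : ℝ)) 0 ≤ u then (1 : ℝ) else 0)) ∧
    -- (3) the one-dimensional laws form a semigroup of Markov kernels
    (∃ κ : ℝ≥0 → Kernel ℝ≥0 ℝ≥0, (∀ t x, κ t x = ESN.esnLaw P b N t x) ∧
      (∀ t, IsMarkovKernel (κ t)) ∧
      κ 0 = Kernel.id ∧ ∀ s t, κ (t + s) = (κ s).comp (κ t)) ∧
    -- (3) Markov property with this semigroup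
    (∀ (x t s : ℝ≥0) (f : ℝ≥0 → ℝ), Measurable f → (∃ C : ℝ, ∀ y, |f y| ≤ C) →
      P[fun ω => f (ESN.esn b N x (t + s) ω) | ESN.past (ESN.esn b N x) t] =ᵐ[P]
        fun ω => ESN.esnSemigroup P b N s f (ESN.esn b N x t ω)) ∧
    -- (3) Feller property
    (∀ (t : ℝ≥0) (f : ZeroAtInftyContinuousMap ℝ≥0 ℝ),
      ∃ g : ZeroAtInftyContinuousMap ℝ≥0 ℝ, ∀ x, g x = ESN.esnSemigroup P b N t f x) ∧
    (∀ f : ZeroAtInftyContinuousMap ℝ≥0 ℝ,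
      TendstoUniformly (fun (t : ℝ≥0) (x : ℝ≥0) => ESN.esnSemigroup P b N t f x) f (𝓝 0)) ∧
    -- (4) stickiness of `0`
    (0 < b → ∀ s : ℝ≥0, 0 < s →
      (0 < P {ω | ESN.esn b N 0 s ω = 0} ↔ ∫⁻ v in Set.Ioc (0 : ℝ) 1, ESN.tail μ v < ∞)) ∧
    (b = 0 → ∀ s : ℝ≥0, 0 < s →
      (0 < P {ω | ESN.esn b N 0 s ω = 0} ↔ μ (Set.Ioi 0) < ∞)) ∧
    (0 ≤ b → (∀ s : ℝ≥0, 0 < s → 0 < P {ω | ESN.esn b N 0 s ω = 0}) →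
      ∀ᵐ ω ∂P, 0 < volume {t : ℝ | 0 < t ∧ ESN.esn b N 0 t.toNNReal ω = 0}) ∧
    -- (5) long-term behaviour
    (0 < b → ∫⁻ v in Set.Ioi (1 : ℝ), ESN.tail μ v = ∞ →
      ∀ x K : ℝ≥0, Tendsto (fun s : ℝ≥0 => P {ω | ESN.esn b N x s ω ≤ K}) atTop (𝓝 0)) ∧
    (0 < b → ∫⁻ v in Set.Ioi (1 : ℝ), ESN.tail μ v < ∞ →
      ∃ π : Measure ℝ≥0, IsProbabilityMeasure π ∧
        (∀ t : ℝ≥0, π.bind (ESN.esnLaw P b N t) = π) ∧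
        (μ ≠ 0 → ∀ a : ℝ≥0, π ≠ Measure.dirac a) ∧
        (∀ u : ℝ≥0, π.real (Set.Iic u) =
          ESN.expNeg (ENNReal.ofReal (1 / b) * ∫⁻ v in Set.Ioi (u : ℝ), ESN.tail μ v)) ∧
        (∀ x : ℝ≥0,
          Tendsto (fun t : ℝ≥0 => ESN.tvDist (ESN.esnLaw P b N t x) π) atTop (𝓝 0)) ∧
        (∀ x t : ℝ≥0, (x : ℝ) / b < t →
          ENNReal.ofReal (ESN.tvDist (ESN.esnLaw P b N t x) π) ≤
            ENNReal.ofReal (1 / b) * ∫⁻ v in Set.Ioi (b * (t : ℝ)), ESN.tail μ v)) := by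
  have : SigmaFinite μ := ESN.sigmaFinite_of_tail hμ_supp hμ_tail
  have hprob := ESN.real_prob_esn_le hN hμ_tail b 0
  simp only [NNReal.coe_zero, zero_sub, ← neg_mul] at hprob
  refine ⟨ESN.measurable_esn hN b, fun n s u hs0 hs => ?_, fun s u => ⟨hprob s u, fun h => ?_,
    fun hb => ?_⟩, fun x t u => ?_, ⟨ESN.esnKernel hN hμ_tail b, fun _ _ => rfl,
    fun t => ⟨fun x => ESN.isProbabilityMeasure_esnLaw hN b t x⟩,
    ESN.esnKernel_zero hN hμ_tail b, fun s t => ESN.esnKernel_add hN hμ_tail b t s⟩,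
    fun x t s f hf ⟨C, hC⟩ => ESN.esn_markov hN hμ_tail b x t s hf hC,
    ESN.exists_zeroAtInfty_esnSemigroup hN hμ_tail b,
    ESN.esnSemigroup_tendstoUniformly hN hμ_tail b,
    fun hb s hs => ESN.prob_esn_eq_zero_pos_iff_of_pos hN hμ_tail hb hs, ?_,
    fun hb h => ESN.ae_volume_zeros_pos hN hμ_tail hb h,
    fun hb hinf => ESN.tendsto_prob_esn_le_of_tail_infinite hN hμ_tail hb hinf,
    fun hb hfin => ⟨ESN.stationaryLaw P b N, Measure.isProbabilityMeasure_map
      (ESN.measurable_peak_linear hN b measurableSet_Ioi).aemeasurable,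
      ESN.stationaryLaw_bind hN hμ_tail hb hfin,
      ESN.stationaryLaw_ne_dirac hN hμ_supp hμ_tail hb hfin, fun u => ?_,
      ESN.tendsto_tvDist_esnLaw hN hμ_tail hb hfin,
      fun x t h => ESN.tvDist_esnLaw_stationaryLaw_le hN hμ_tail hb hfin h⟩⟩
  · have h := ESN.fdd_esn hN hμ_tail b s u hs0 hs
    refine ⟨h, fun hb => ?_⟩
    rw [h, ESN.fddExponent_strictTail_eq_tail hb]
  · rw [hprob, ESN.lintegral_decay_strictTail_eq_tail h]
  · rw [hprob, ESN.lintegral_decay_strictTail_eq_tail (Or.inl hb), ESN.lintegral_tail_decay hb]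
  · rw [hprob, ESN.real_prob_esn_le hN hμ_tail, mul_assoc]
    congr 1
    -- Since `x ≥ 0`, the indicator for `x` absorbs the one for 0.
    rcases le_or_gt (max ((x : ℝ) - b * t) 0) u with h | h
    · have h' : max (-b * (t : ℝ)) 0 ≤ u :=
        (max_le_max_right 0 (by linarith [x.coe_nonneg])).trans h
      rw [if_pos h, if_pos h', mul_one]
    · rw [if_neg h.not_ge, mul_zero]
  · rintro rfl s hs
    exact ESN.prob_esn_eq_zero_pos_iff_of_eq_zero hN hμ_tail hs
  · rw [Measure.real, ESN.stationaryLaw_Iic hN hb hfin,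
      ENNReal.toReal_ofReal (ESN.expNeg_nonneg _)]
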